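/- **Setting.** Let $\mathcal V\in\{0,1\}$ be a memoryless source with $P(\mathcal V=1)=p\in[0,1]$, let $\beta\in[0,\tfrac12)$, $n=2^m$ and $\delta_n=2^{-n^\beta}$. Let $G_n=P_n\begin{bmatrix}1&0\\1&1\end{bmatrix}^{\otimes m}$ over $\mathbb F_2$, where $P_n$ is the bit-reversal matrix, and $A=V^TG_n$ for a block $V$ of $n$ source bits. Put $\mathcal H_V=\{j:H(A^{(j)}|A^{j-1})>1-\delta_n\}$, $\mathcal U_V=\{j:H(A^{(j)}|A^{j-1})<\delta_n\}$ (entropies in bits) and $\mathcal J_V=(\mathcal H_V\cup\mathcal U_V)^c$. *Compression.* Alice has $\ell$ independent messages $V_1,\dots,V_\ell$ of $n$ source bits each, and for each message an independent uniform seed of $d_J\ge|\mathcal J_V|$ bits that is shared with Bob. A message is compressed into $\tilde n=|\mathcal H_V|+d_J$ bits: the bits $A[\mathcal H_V]$, followed by the sum mod 2 of the seed and of $A[\mathcal J_V]$ (extended by zeros to length $d_J$). *Mixing.* Let $w<\ell$ and $\mu\ge\ell$. The bits of each compressed message are grouped, $\mu$ at a time, into $\lceil\tilde n/\mu\rceil$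 symbols of $\mathbb F_{2^\mu}$ through an $\mathbb F_2$-linear isomorphism $\mathbb F_2^\mu\to\mathbb F_{2^\mu}$; if $\mu\nmid\tilde n$, the last symbol is completed by independent uniform bits. Each column $M\in\mathbb F_{2^\mu}^\ell$ of the message matrix is encoded as $X^T=M^TG_{IS}$ with an invertible matrix $G_{IS}\in\mathbb F_{2^\mu}^{\ell\times\ell}$, and the $i$-th coordinates of the columns are sent over the $i$-th noiseless link. The code is *MRD-based for* a set $\mathcal K_s$ of $k_s\le\ell-w$ messages if the rows of $G_{IS}$ outside $\mathcal K_s$ generate a maximum rank distance code $\mathcal C$, i.e. every nonzero $c\in\mathcal C$ has entries spanning an $\mathbb F_2$-space of dimension at least $\ell-\dim\mathcal C+1$ (so the messages in $\mathcal K_s$ select the coset of $\mathcal C$ and the other messages select the codeword in the coset). *Decoding and observations.* Bob inverts the linear code, removes the one-time pad, recovers the bits of $A$ in $\mathcal U_V$ by successive cancellation (maximum a posteriori decisions), and inverts $G_n$; $\hat{\underline V}_{\mathcal L}$ is his estimate of all the messages $\underline V_{\mathcal L}$. The eavesdropper observes the symbols $\underline Z_{\mathcal W}$ on the links of a set $\mathcal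 W$ with $|\mathcal W|=w$. $\mathbb V(q,q')=\sum_z|q(z)-q'(z)|$ is the non-normalized variational distance. **Theorem.** 1. For every $m$ and every such scheme, $$\mathbb P(\hat{\underline V}_{\mathcal L}\ne\underline V_{\mathcal L})\le\ell\,|\mathcal U_V|\,2^{-n^\beta}\ (\le\ell n2^{-n^\beta}),$$ and for every set $\mathcal K_s$ of $k_s\le\ell-w$ messages for which the code is MRD-based, every $\mathcal W$ with $|\mathcal W|=w$ and every $\underline v_{\mathcal K_s}$ of positive probability, $$\mathbb V\left(p_{\underline Z_{\mathcal W}|\underline V_{\mathcal K_s}=\underline v_{\mathcal K_s}},p_{\underline Z_{\mathcal W}}\right)\le2\sqrt{2\ell\tilde n2^{-n^\beta}}.\qquad(*)$$ 2. For all $w<\ell\le\mu$: for every set $\mathcal K_s$ of at most $\ell-w$ messages there is an invertible $G_{IS}$ over $\mathbb F_{2^\mu}$ that is MRD-based for $\mathcal K_s$; and there is an invertible $G_{IS}$ over $\mathbb F_{2^\mu}$, depending only on $\ell,w,\mu$, with which $(*)$ holds for all sets $\mathcal K_s$ of $k_s\le\ell-w$ messages simultaneously (and for all $m$, all $d_J\ge|\mathcal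 J_V|$, all symbol maps, all $\mathcal W$ with $|\mathcal W|=w$ and all $\underline v_{\mathcal K_s}$ of positive probability). 3. For every $0\le\beta'<\beta$ there is an $m_0$ such that for all $m\ge m_0$ every such scheme has error probability at most $\ell\,2^{-n^{\beta'}}$. 4. For every sequence of such schemes, one for each $m$, with $\ell=o(2^{n^\beta}/\tilde n)$ as $m\to\infty$, the error probability and the leakage bound $2\sqrt{2\ell\tilde n2^{-n^\beta}}$ tend to $0$. -/

import Mathlib

open Filter Asymptotics

noncomputable section

namespace NUHUNCC

/-! ### Finite probability -/

open scoped Classical in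
/-- Probability of an event under a probability mass function on a finite sample space. -/
def prob {Ω : Type*} [Fintype Ω] (P : Ω → ℝ) (E : Ω → Prop) : ℝ :=
  ∑ ω, if E ω then P ω else 0

/-- Conditional entropy `H(X | Y)` in bits; terms of probability zero contribute `0`. -/
def condEntropy {Ω α γ : Type*} [Fintype Ω] [Fintype α] [Fintype γ]
    (P : Ω → ℝ) (X : Ω → α) (Y : Ω → γ) : ℝ :=
  -∑ y : γ, ∑ x : α, prob P (fun ω => X ω = x ∧ Y ω = y) *
      Real.logb 2 (prob P (fun ω => X ω = x ∧ Y ω = y) / prob P (fun ω => Y ω = y))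

/-- Law of a block of i.i.d. bits, each equal to `1` with probability `p`. -/
def srcProb (p : ℝ) {n : ℕ} (v : Fin n → ZMod 2) : ℝ :=
  ∏ t, if v t = 1 then p else 1 - p

/-! ### Polar source code, blocklength `n = 2 ^ m` -/

/-- The bits of an index in `{0, …, 2 ^ m - 1}`, least significant first. -/
def bitsOf {m : ℕ} (i : Fin (2 ^ m)) : Fin m → Fin 2 := finFunctionFinEquiv.symm i

/-- The index obtained by reversing the `m` bits. -/
def bitRev {m : ℕ} (i : Fin (2 ^ m)) : Fin (2 ^ m) :=
  finFunctionFinEquiv (fun t => bitsOf i (Fin.rev t))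

/-- The polarization kernel. -/
def kernel : Matrix (Fin 2) (Fin 2) (ZMod 2) := !![1, 0; 1, 1]

/-- The `m`-fold Kronecker power of the kernel. -/
def kernelPow (m : ℕ) : Matrix (Fin (2 ^ m)) (Fin (2 ^ m)) (ZMod 2) :=
  Matrix.of fun i j => ∏ t : Fin m, kernel (bitsOf i t) (bitsOf j t)

/-- The bit-reversal permutation matrix. -/
def bitRevMatrix (m : ℕ) : Matrix (Fin (2 ^ m)) (Fin (2 ^ m)) (ZMod 2) :=
  Matrix.of fun i j => if j = bitRev i then 1 else 0

/-- The polarization transform `G_n = P_n F^{⊗ m}`. -/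
def polarG (m : ℕ) : Matrix (Fin (2 ^ m)) (Fin (2 ^ m)) (ZMod 2) :=
  bitRevMatrix m * kernelPow m

/-- The polarized vector `A = Vᵀ G_n`. -/
def polarize (m : ℕ) (v : Fin (2 ^ m) → ZMod 2) : Fin (2 ^ m) → ZMod 2 :=
  Matrix.vecMul v (polarG m)

/-- `H(A^{(j)} | A^{j-1})`. -/
def bitEntropy (p : ℝ) (m : ℕ) (j : Fin (2 ^ m)) : ℝ :=
  condEntropy (srcProb p) (fun v => polarize m v j)
    (fun v (i : Fin j) => polarize m v (Fin.castLE j.isLt.le i))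

/-- `δ_n = 2 ^ (-n ^ β)` for `n = 2 ^ m`. -/
def delta (β : ℝ) (m : ℕ) : ℝ := (2 : ℝ) ^ (-(((2 : ℝ) ^ m) ^ β))

/-- Indices of nearly uniform bits. -/
def setH (p β : ℝ) (m : ℕ) : Finset (Fin (2 ^ m)) :=
  Finset.univ.filter fun j => 1 - delta β m < bitEntropy p m j

/-- Indices of nearly deterministic bits. -/
def setU (p β : ℝ) (m : ℕ) : Finset (Fin (2 ^ m)) :=
  Finset.univ.filter fun j => bitEntropy p m j < delta β m

/-- The remaining indices. -/
def setJ (p β : ℝ) (m : ℕ) : Finset (Fin (2 ^ m)) := (setU p β m ∪ setH p β m)ᶜ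

/-- Length `ñ = |H_V| + d_J` of a compressed message with a seed of `d` bits. -/
def compLen (p β : ℝ) (m d : ℕ) : ℕ := (setH p β m).card + d

/-- Source encoder: the bits of `A` in `H_V`, followed by the seed added (mod 2) to the bits of `A`
in `J_V`. If the seed is longer than `J_V`, its remaining bits are appended unchanged. -/
def srcEncode (p β : ℝ) (m d : ℕ) (v : Fin (2 ^ m) → ZMod 2) (u : Fin d → ZMod 2) :
    Fin (compLen p β m d) → ZMod 2 :=
  Fin.append
    (fun i => polarize m v ((setH p β m).orderEmbOfFin rfl i))
    (fun i => (if h : i.val < (setJ p β m).card then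
        polarize m v ((setJ p β m).orderEmbOfFin rfl ⟨i.val, h⟩) else 0) + u i)

/-- Maximum a posteriori decision on the bit `A^{(j)}` given that the earlier bits agree with `a`
(the entries of `a` from `j` on are not used). -/
def mapBit (p : ℝ) (m : ℕ) (j : Fin (2 ^ m)) (a : Fin (2 ^ m) → ZMod 2) : ZMod 2 :=
  if prob (srcProb p) (fun v => (∀ i < j, polarize m v i = a i) ∧ polarize m v j = 1) ≤
      prob (srcProb p) (fun v => (∀ i < j, polarize m v i = a i) ∧ polarize m v j = 0)
  then 0 else 1

/-- Successive cancellation decoding: outside `U_V` the bits are copied from `known`, in `U_V` they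
are decided one after the other from the bits decoded before. -/
def scDecode (p β : ℝ) (m : ℕ) (known : Fin (2 ^ m) → ZMod 2) (j : Fin (2 ^ m)) : ZMod 2 :=
  if j ∈ setU p β m then
    mapBit p m j (fun i => if _h : i.val < j.val then scDecode p β m known i else 0)
  else known j
termination_by j.val

/-- The bits of `A` outside `U_V`, read off from a compressed message and the seed. -/
def knownBits (p β : ℝ) (m d : ℕ) (M : Fin (compLen p β m d) → ZMod 2) (u : Fin d → ZMod 2)
    (j : Fin (2 ^ m)) : ZMod 2 :=
  if hH : j ∈ setH p β m then
    M (Fin.castAdd d (((setH p β m).orderIsoOfFin rfl).symm ⟨j, hH⟩))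
  else if hJ : j ∈ setJ p β m then
    if h : (((setJ p β m).orderIsoOfFin rfl).symm ⟨j, hJ⟩).val < d then
      M (Fin.natAdd (setH p β m).card ⟨_, h⟩) + u ⟨_, h⟩
    else 0
  else 0

/-- Source decoder: remove the one-time pad, decode `A` successively, invert the transform. -/
def srcDecode (p β : ℝ) (m d : ℕ) (M : Fin (compLen p β m d) → ZMod 2) (u : Fin d → ZMod 2) :
    Fin (2 ^ m) → ZMod 2 :=
  Matrix.vecMul (scDecode p β m (knownBits p β m d M u)) (polarG m)⁻¹

/-! ### Linear code over `𝔽_{2^μ}` -/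

/-- Number `⌈ñ / μ⌉` of symbols per message. -/
def symCount (N μ : ℕ) : ℕ := N ⌈/⌉ μ

/-- Number of bits that are missing in the last symbol of a message of `N` bits. -/
def fillLen (N μ : ℕ) : ℕ := symCount N μ * μ - N

theorem fill_index_lt {N μ : ℕ} (s : Fin (symCount N μ)) (b : Fin μ)
    (h : ¬ s.val * μ + b.val < N) : s.val * μ + b.val - N < fillLen N μ := by
  have h1 : (s.val + 1) * μ ≤ symCount N μ * μ := Nat.mul_le_mul_right μ s.isLt
  have h2 := b.isLt
  rw [Nat.add_mul, Nat.one_mul] at h1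
  unfold fillLen
  omega

theorem bit_index_lt {N μ : ℕ} (t : Fin N) (hμ : 0 < μ) : t.val / μ < symCount N μ := by
  unfold symCount
  rw [Nat.ceilDiv_eq_add_pred_div, Nat.div_lt_iff_lt_mul hμ]
  have h1 := Nat.div_add_mod (N + μ - 1) μ
  have h2 := Nat.mod_lt (N + μ - 1) hμ
  have h3 := t.isLt
  rw [Nat.mul_comm] at h1
  omega

/-- Grouping of a message of `N` bits into symbols of `μ` bits each, mapped to `𝔽_{2^μ}`; the last
symbol is completed by the bits `r`. -/
def toSymbols {N μ : ℕ} (φ : (Fin μ → ZMod 2) ≃ₗ[ZMod 2] GaloisField 2 μ)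
    (M : Fin N → ZMod 2) (r : Fin (fillLen N μ) → ZMod 2) (s : Fin (symCount N μ)) :
    GaloisField 2 μ :=
  φ fun b => if h : s.val * μ + b.val < N then M ⟨s.val * μ + b.val, h⟩
    else r ⟨s.val * μ + b.val - N, fill_index_lt s b h⟩

/-- The inverse grouping; the bits that complete the last symbol are dropped. -/
def fromSymbols {N μ : ℕ} (φ : (Fin μ → ZMod 2) ≃ₗ[ZMod 2] GaloisField 2 μ)
    (x : Fin (symCount N μ) → GaloisField 2 μ) (t : Fin N) : ZMod 2 :=
  if hμ : 0 < μ then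
    φ.symm (x ⟨t.val / μ, bit_index_lt t hμ⟩) ⟨t.val % μ, Nat.mod_lt _ hμ⟩
  else 0

/-- The rank weight of a word over `𝔽_{2^μ}`: the `𝔽_2`-dimension of the span of its entries. -/
def rankWeight {μ ℓ : ℕ} (c : Fin ℓ → GaloisField 2 μ) : ℕ :=
  Module.finrank (ZMod 2) (Submodule.span (ZMod 2) (Set.range c))

/-- Maximum rank distance code of length `ℓ ≤ μ`: every nonzero codeword has rank weight at
least `ℓ - dim C + 1`, the Singleton bound. -/
def IsMRD {μ ℓ : ℕ} (C : Submodule (GaloisField 2 μ) (Fin ℓ → GaloisField 2 μ)) : Prop :=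
  ∀ c ∈ C, c ≠ 0 → ℓ + 1 ≤ rankWeight c + Module.finrank (GaloisField 2 μ) C

/-- The code `C` spanned by the rows of the encoding matrix outside `Ks`. For an invertible matrix
these rows are a generator matrix `G` of `C`, the rows in `Ks` are the matrix `G*`, and the
messages in `Ks` select the coset of `C`. -/
def rowCode {μ ℓ : ℕ} (G : Matrix (Fin ℓ) (Fin ℓ) (GaloisField 2 μ)) (Ks : Finset (Fin ℓ)) :
    Submodule (GaloisField 2 μ) (Fin ℓ → GaloisField 2 μ) :=
  Submodule.span (GaloisField 2 μ) (G '' {k | k ∉ Ks})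

/-! ### The whole scheme -/

/-- Outcomes: the `ℓ` source messages, the `ℓ` seeds, and the fill bits of the last symbols. -/
abbrev Outcome (p β : ℝ) (m ℓ μ d : ℕ) : Type :=
  (Fin ℓ → Fin (2 ^ m) → ZMod 2) × (Fin ℓ → Fin d → ZMod 2) ×
    (Fin ℓ → Fin (fillLen (compLen p β m d) μ) → ZMod 2)

/-- Joint law: independent source messages; seeds and fill bits uniform; all independent. -/
def law (p β : ℝ) (m ℓ μ d : ℕ) (ω : Outcome p β m ℓ μ d) : ℝ :=
  (∏ i, srcProb p (ω.1 i)) *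
    (Fintype.card (Fin ℓ → Fin d → ZMod 2) : ℝ)⁻¹ *
    (Fintype.card (Fin ℓ → Fin (fillLen (compLen p β m d) μ) → ZMod 2) : ℝ)⁻¹

/-- The message matrix over `𝔽_{2^μ}`. -/
def msgMatrix (p β : ℝ) (m ℓ μ d : ℕ) (φ : (Fin μ → ZMod 2) ≃ₗ[ZMod 2] GaloisField 2 μ)
    (ω : Outcome p β m ℓ μ d) :
    Matrix (Fin ℓ) (Fin (symCount (compLen p β m d) μ)) (GaloisField 2 μ) :=
  Matrix.of fun i => toSymbols φ (srcEncode p β m d (ω.1 i) (ω.2.1 i)) (ω.2.2 i)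

/-- The codeword matrix, each column being `x = Mᵀ G_IS`; row `i` is sent over link `i`. -/
def codeword (p β : ℝ) (m ℓ μ d : ℕ) (φ : (Fin μ → ZMod 2) ≃ₗ[ZMod 2] GaloisField 2 μ)
    (G : Matrix (Fin ℓ) (Fin ℓ) (GaloisField 2 μ)) (ω : Outcome p β m ℓ μ d) :
    Matrix (Fin ℓ) (Fin (symCount (compLen p β m d) μ)) (GaloisField 2 μ) :=
  G.transpose * msgMatrix p β m ℓ μ d φ ω

/-- Bob's decoder from the received links and the shared seeds. The rows of `(G_ISᵀ)⁻¹` are the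
parity check matrix `H` and the complementary decoding matrix. -/
def decode (p β : ℝ) (m ℓ μ d : ℕ) (φ : (Fin μ → ZMod 2) ≃ₗ[ZMod 2] GaloisField 2 μ)
    (G : Matrix (Fin ℓ) (Fin ℓ) (GaloisField 2 μ))
    (Y : Matrix (Fin ℓ) (Fin (symCount (compLen p β m d) μ)) (GaloisField 2 μ))
    (u : Fin ℓ → Fin d → ZMod 2) : Fin ℓ → Fin (2 ^ m) → ZMod 2 :=
  fun i => srcDecode p β m d (fromSymbols φ ((G.transpose⁻¹ * Y) i)) (u i)

/-- Probability that Bob does not recover the whole source message matrix. -/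
def errorProb (p β : ℝ) (m ℓ μ d : ℕ) (φ : (Fin μ → ZMod 2) ≃ₗ[ZMod 2] GaloisField 2 μ)
    (G : Matrix (Fin ℓ) (Fin ℓ) (GaloisField 2 μ)) : ℝ :=
  prob (law p β m ℓ μ d) fun ω =>
    decode p β m ℓ μ d φ G (codeword p β m ℓ μ d φ G ω) ω.2.1 ≠ ω.1

/-- The observations of an eavesdropper on the links in `W`. -/
def eveObs (p β : ℝ) (m ℓ μ d : ℕ) (φ : (Fin μ → ZMod 2) ≃ₗ[ZMod 2] GaloisField 2 μ)
    (G : Matrix (Fin ℓ) (Fin ℓ) (GaloisField 2 μ)) (W : Finset (Fin ℓ))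
    (ω : Outcome p β m ℓ μ d) (i : W) (s : Fin (symCount (compLen p β m d) μ)) :
    GaloisField 2 μ :=
  codeword p β m ℓ μ d φ G ω i s

/-- The source messages with index in `Ks`. -/
def srcOn {p β : ℝ} {m ℓ μ d : ℕ} (Ks : Finset (Fin ℓ)) (ω : Outcome p β m ℓ μ d) (i : Ks) :
    Fin (2 ^ m) → ZMod 2 :=
  ω.1 i

instance fintypeGaloisField (μ : ℕ) : Fintype (GaloisField 2 μ) := Fintype.ofFinite _

/-- The non-normalized variational distance between the conditional law of the observations on `W`
given `V_Ks = v` and their unconditional law. -/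
def leakage (p β : ℝ) (m ℓ μ d : ℕ) (φ : (Fin μ → ZMod 2) ≃ₗ[ZMod 2] GaloisField 2 μ)
    (G : Matrix (Fin ℓ) (Fin ℓ) (GaloisField 2 μ)) (W Ks : Finset (Fin ℓ))
    (v : Ks → Fin (2 ^ m) → ZMod 2) : ℝ :=
  ∑ z : W → Fin (symCount (compLen p β m d) μ) → GaloisField 2 μ,
    |prob (law p β m ℓ μ d) (fun ω => eveObs p β m ℓ μ d φ G W ω = z ∧ srcOn Ks ω = v) /
        prob (law p β m ℓ μ d) (fun ω => srcOn Ks ω = v) -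
      prob (law p β m ℓ μ d) (fun ω => eveObs p β m ℓ μ d φ G W ω = z)|

/-- The eavesdropper on any `w` links stays ignorant of the messages in `Ks`, up to `ε`. -/
def SecuresUpTo (ε p β : ℝ) (m ℓ w μ d : ℕ) (φ : (Fin μ → ZMod 2) ≃ₗ[ZMod 2] GaloisField 2 μ)
    (G : Matrix (Fin ℓ) (Fin ℓ) (GaloisField 2 μ)) (Ks : Finset (Fin ℓ)) : Prop :=
  ∀ W : Finset (Fin ℓ), W.card = w → ∀ v : Ks → Fin (2 ^ m) → ZMod 2,
    prob (law p β m ℓ μ d) (fun ω => srcOn Ks ω = v) ≠ 0 →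
      leakage p β m ℓ μ d φ G W Ks v ≤ ε

/-- The leakage bound `2 √(2 ℓ ñ 2^{-n^β})`. -/
def leakBound (p β : ℝ) (m ℓ d : ℕ) : ℝ :=
  2 * Real.sqrt (2 * ℓ * compLen p β m d * delta β m)

end NUHUNCC

end

noncomputable section

namespace NUHUNCC

/-! ### Elementary finite probability -/

section FiniteProbability

open scoped Classical

variable {Ω α γ ι : Type*} [Fintype Ω] [Fintype α] [Fintype γ]

/-! Reliability. Inverting the linear code, the grouping into symbols and the one-time pad is exact,
so Bob errs only in successive cancellation, and only if some single decision made from the true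
past is wrong. A wrong maximum a posteriori decision means that the actual bit had conditional
probability at most 1/2, so the outcome contributes at least one bit of information; hence the error
probability of decision `j` is at most `H(A_j | past)` (`prob_mapBit_ne_le`). A union bound over
`U_V` and the `ℓ` messages finishes.

Secrecy. Replace the law of each source block outside `Ks` by `tilt`: the bits of `A` in `H_V`
become fair coins and the others keep their conditional laws. By the chain rule the relative entropy
to the tilted law is exactly `log 2 * ∑_{j ∈ H_V} (1 - H(A_j | past))`, at most `|H_V| δ_n`; it adds
up over messages, and `pinsker` turns it into variational distance. Under the tilted law the symbols
of a message are exactly uniform, since the bits in `H_V`, the padded bits and the fill bits all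
are. If the messages outside `Ks` alone can produce every observation on `W` (`MixesOnto`), the
observation is then exactly uniform whatever the laws in `Ks`. So both the conditional law (point
masses in `Ks`) and the unconditional law lie within `√(2 ℓ ñ δ_n)` of the uniform law, and the
triangle inequality gives the factor 2.

Codes. An MRD code mixes because a nonzero codeword vanishing on `dim C` coordinates would have too
small a rank weight. Gabidulin codes give MRD matrices for one set `Ks`; a Cauchy matrix, all of
whose square submatrices are invertible, mixes for all `Ks` at once.

Asymptotics. `n 2^{-n^β} ≤ 2^{-n^{β'}}` for large `n`. In the last claim `n` must be compared with
`ñ`: the total entropy grows linearly in `n` unless the source is deterministic, and it is at most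
`ñ + n δ_n`. No estimate of the fraction of polarized indices is needed. -/

theorem prob_eq_sum (P : Ω → ℝ) (E : Ω → Prop) [DecidablePred E] :
    prob P E = ∑ ω, if E ω then P ω else 0 := by
  unfold prob
  congr!

theorem prob_nonneg {P : Ω → ℝ} (hP : ∀ ω, 0 ≤ P ω) (E : Ω → Prop) : 0 ≤ prob P E :=
  Finset.sum_nonneg fun ω _ => by split_ifs; exacts [hP ω, le_rfl]

theorem prob_congr (P : Ω → ℝ) {E E' : Ω → Prop} (h : ∀ ω, E ω ↔ E' ω) :
    prob P E = prob P E' := by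
  have : E = E' := funext fun ω => propext (h ω)
  rw [this]

theorem prob_mono {P : Ω → ℝ} (hP : ∀ ω, 0 ≤ P ω) {E E' : Ω → Prop} (h : ∀ ω, E ω → E' ω) :
    prob P E ≤ prob P E' :=
  Finset.sum_le_sum fun ω _ => by
    by_cases h1 : E ω
    · simp [h1, h ω h1]
    · simp only [h1, if_false]
      split_ifs; exacts [hP ω, le_rfl]

theorem le_prob {P : Ω → ℝ} (hP : ∀ ω, 0 ≤ P ω) {E : Ω → Prop} {ω : Ω} (h : E ω) :
    P ω ≤ prob P E := by
  have := Finset.single_le_sum (f := fun ω => if E ω then P ω else 0) (s := Finset.univ)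
    (fun ω _ => by split_ifs; exacts [hP ω, le_rfl]) (Finset.mem_univ ω)
  rwa [if_pos h] at this

theorem prob_of_forall (P : Ω → ℝ) {E : Ω → Prop} (h : ∀ ω, E ω) : prob P E = ∑ ω, P ω := by
  simp [prob, h]

theorem prob_exists_le {P : Ω → ℝ} (hP : ∀ ω, 0 ≤ P ω) (s : Finset ι) (E : ι → Ω → Prop) :
    prob P (fun ω => ∃ i ∈ s, E i ω) ≤ ∑ i ∈ s, prob P (E i) := by
  unfold prob
  rw [Finset.sum_comm]
  refine Finset.sum_le_sum fun ω _ => ?_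
  have h0 : ∀ i ∈ s, (0 : ℝ) ≤ if E i ω then P ω else 0 := fun i _ => by
    split_ifs; exacts [hP ω, le_rfl]
  by_cases h : ∃ i ∈ s, E i ω
  · obtain ⟨i, hi, hE⟩ := h
    rw [if_pos ⟨i, hi, hE⟩]
    have := Finset.single_le_sum h0 hi
    simpa [hE] using this
  · rw [if_neg h]
    exact Finset.sum_nonneg h0

theorem prob_mul_const (P : Ω → ℝ) (c : ℝ) (E : Ω → Prop) :
    prob (fun ω => c * P ω) E = c * prob P E := by
  simp [prob, Finset.mul_sum, mul_ite]

/-- Total probability over the values of a random variable. -/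
theorem sum_prob_and (P : Ω → ℝ) (f : Ω → α) (E : Ω → Prop) :
    ∑ a, prob P (fun ω => E ω ∧ f ω = a) = prob P E := by
  unfold prob
  rw [Finset.sum_comm]
  refine Finset.sum_congr rfl fun ω _ => ?_
  by_cases h : E ω <;> simp [h]

theorem sum_prob_eq (P : Ω → ℝ) (f : Ω → α) : ∑ a, prob P (fun ω => f ω = a) = ∑ ω, P ω := by
  have := sum_prob_and P f (fun _ => True)
  simpa [prob] using this

/-- Conditional entropy as the expected information of the actual outcome. -/
theorem condEntropy_eq_sum (P : Ω → ℝ) (X : Ω → α) (Y : Ω → γ) :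
    condEntropy P X Y = -∑ ω, P ω * Real.logb 2
      (prob P (fun ω' => X ω' = X ω ∧ Y ω' = Y ω) / prob P (fun ω' => Y ω' = Y ω)) := by
  unfold condEntropy
  congr 1
  have h : ∀ (y : γ) (x : α), prob P (fun ω => X ω = x ∧ Y ω = y) *
      Real.logb 2 (prob P (fun ω => X ω = x ∧ Y ω = y) / prob P (fun ω => Y ω = y)) =
      ∑ ω, if X ω = x ∧ Y ω = y then P ω * Real.logb 2
      (prob P (fun ω' => X ω' = X ω ∧ Y ω' = Y ω) / prob P (fun ω' => Y ω' = Y ω)) else 0 := by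
    intro y x
    conv_lhs => enter [1]; rw [prob]
    rw [Finset.sum_mul]
    refine Finset.sum_congr rfl fun ω _ => ?_
    by_cases hω : X ω = x ∧ Y ω = y
    · obtain ⟨rfl, rfl⟩ := hω
      rw [if_pos ⟨rfl, rfl⟩, if_pos ⟨rfl, rfl⟩]
    · rw [if_neg hω, if_neg hω, zero_mul]
  simp_rw [h]
  calc _ = ∑ y : γ, ∑ ω, ∑ x : α, (if X ω = x ∧ Y ω = y then P ω * Real.logb 2
      (prob P (fun ω' => X ω' = X ω ∧ Y ω' = Y ω) / prob P (fun ω' => Y ω' = Y ω)) else 0) :=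
        Finset.sum_congr rfl fun y _ => Finset.sum_comm
    _ = _ := by
      rw [Finset.sum_comm]
      refine Finset.sum_congr rfl fun ω _ => ?_
      simp [ite_and]

/-- Expectation of a function of one coordinate under a product law. -/
theorem sum_prod_mul_apply [Fintype ι] [DecidableEq ι] {P : ι → α → ℝ}
    (hP : ∀ i, ∑ a, P i a = 1) (i : ι) (g : α → ℝ) :
    ∑ v : ι → α, (∏ j, P j (v j)) * g (v i) = ∑ a, P i a * g a := by
  have h : ∀ v : ι → α, (∏ j, P j (v j)) * g (v i) =
      ∏ j, (P j (v j) * if j = i then g (v j) else 1) := fun v => by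
    rw [Finset.prod_mul_distrib]
    simp
  simp_rw [h]
  rw [← Fintype.prod_sum fun j a => P j a * if j = i then g a else 1,
    Finset.prod_eq_single i]
  · simp
  · intro j _ hj
    simp [hj, hP]
  · simp

theorem sum_prod_eq_one [Fintype ι] [DecidableEq ι] {P : ι → α → ℝ} (hP : ∀ i, ∑ a, P i a = 1) :
    ∑ v : ι → α, ∏ j, P j (v j) = 1 := by
  rw [← Fintype.prod_sum]
  simp [hP]

/-- Image of a product law under a coordinatewise map. -/
theorem sum_prod_mul_comp [Fintype ι] [DecidableEq ι] (w : ι → Ω → ℝ)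
    (f : Ω → α) (g : (ι → α) → ℝ) :
    ∑ b : ι → Ω, (∏ i, w i (b i)) * g (fun i => f (b i)) =
      ∑ x : ι → α, (∏ i, prob (w i) (fun b => f b = x i)) * g x := by
  have h : ∀ x : ι → α, ∏ i, prob (w i) (fun b => f b = x i) =
      ∑ b : ι → Ω, if (fun i => f (b i)) = x then ∏ i, w i (b i) else 0 := by
    intro x
    unfold prob
    rw [Fintype.prod_sum fun i b => if f b = x i then w i b else 0]
    refine Finset.sum_congr rfl fun b _ => ?_
    by_cases hb : (fun i => f (b i)) = x
    · rw [if_pos hb]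
      exact Finset.prod_congr rfl fun i _ => if_pos (congrFun hb i)
    · rw [if_neg hb]
      obtain ⟨i, hi⟩ := Function.ne_iff.mp hb
      exact Finset.prod_eq_zero (Finset.mem_univ i) (if_neg hi)
  simp_rw [h, Finset.sum_mul]
  rw [Finset.sum_comm]
  refine Finset.sum_congr rfl fun b _ => ?_
  simp [ite_mul]

end FiniteProbability

/-! ### Pinsker's inequality -/

section Pinsker

open Real InformationTheory

/-- Together with its mirror image under `x ↦ x⁻¹` below, this gives the sign of the derivative in
the pointwise form of Pinsker's inequality. -/
theorem two_mul_sub_one_le_log {x : ℝ} (hx : 1 ≤ x) : 2 * (x - 1) ≤ (x + 1) * log x := by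
  have h := Real.le_log_one_add_of_nonneg (x := x - 1) (by linarith)
  rw [div_le_iff₀ (by linarith)] at h
  rw [show 1 + (x - 1) = x by ring] at h
  linarith

theorem log_le_two_mul_sub_one {x : ℝ} (hx0 : 0 < x) (hx : x ≤ 1) :
    (x + 1) * log x ≤ 2 * (x - 1) := by
  have h := two_mul_sub_one_le_log (x := x⁻¹) ((one_le_inv₀ hx0).2 hx)
  rw [Real.log_inv] at h
  have h2 := mul_le_mul_of_nonneg_left h hx0.le
  have h3 : x * (2 * (x⁻¹ - 1)) = 2 * (1 - x) := by field_simp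
  have h4 : x * ((x⁻¹ + 1) * -log x) = -((x + 1) * log x) := by field_simp; ring
  rw [h3, h4] at h2
  linarith

/-- The difference of the two sides vanishes at 1 and its derivative has the sign of `x - 1`, so 1
is its minimum. -/
theorem three_mul_sub_one_sq_le_klFun {x : ℝ} (hx : 0 ≤ x) :
    3 * (x - 1) ^ 2 ≤ (2 * x + 4) * klFun x := by
  set g : ℝ → ℝ := fun x => (2 * x + 4) * klFun x - 3 * (x - 1) ^ 2 with hg
  have hcont : Continuous g := by
    have := continuous_klFun
    fun_prop
  have hder : ∀ y : ℝ, 0 < y → HasDerivAt g (4 * ((y + 1) * log y - 2 * (y - 1))) y := by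
    intro y hy
    have h1 : HasDerivAt (fun x : ℝ => 2 * x + 4) 2 y := by
      simpa using ((hasDerivAt_id y).const_mul 2).add_const 4
    have h2 := hasDerivAt_klFun hy.ne'
    have h3 : HasDerivAt (fun x : ℝ => 3 * (x - 1) ^ 2) (6 * (y - 1)) y := by
      refine ((((hasDerivAt_id y).sub_const 1).pow 2).const_mul 3).congr_deriv ?_
      simp only [id]
      norm_num
      ring
    refine ((h1.mul h2).sub h3).congr_deriv ?_
    rw [klFun_apply]
    ring
  have hg1 : g 1 = 0 := by simp [hg, klFun_one]
  suffices 0 ≤ g x by simpa [hg] using this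
  rcases le_total 1 x with h | h
  · rw [← hg1]
    refine monotoneOn_of_deriv_nonneg (convex_Ici 1) hcont.continuousOn ?_ ?_
      Set.self_mem_Ici h h
    · intro y hy
      rw [interior_Ici] at hy
      exact (hder y (lt_trans one_pos hy)).differentiableAt.differentiableWithinAt
    · intro y hy
      rw [interior_Ici] at hy
      rw [(hder y (lt_trans one_pos hy)).deriv]
      have := two_mul_sub_one_le_log (le_of_lt hy)
      linarith
  · rw [← hg1]
    refine antitoneOn_of_deriv_nonpos (convex_Icc 0 1) hcont.continuousOn ?_ ?_
      ⟨hx, h⟩ ⟨zero_le_one, le_rfl⟩ h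
    · intro y hy
      rw [interior_Icc] at hy
      exact (hder y hy.1).differentiableAt.differentiableWithinAt
    · intro y hy
      rw [interior_Icc] at hy
      rw [(hder y hy.1).deriv]
      have := log_le_two_mul_sub_one hy.1 hy.2.le
      linarith

/-- Relative entropy of finite families in nats. -/
def relEntropy {Ω : Type*} [Fintype Ω] (P Q : Ω → ℝ) : ℝ := ∑ ω, P ω * log (P ω / Q ω)

/-- Cauchy–Schwarz applied to the pointwise inequality: `|P - Q|²` is at most the product of `(2P +
4Q)/3`, of total mass 2, and `Q * klFun (P/Q)`, of total mass the relative entropy. -/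
theorem pinsker {Ω : Type*} [Fintype Ω] {P Q : Ω → ℝ} (hP : ∀ ω, 0 ≤ P ω) (hQ : ∀ ω, 0 ≤ Q ω)
    (hPQ : ∀ ω, Q ω = 0 → P ω = 0) (hP1 : ∑ ω, P ω = 1) (hQ1 : ∑ ω, Q ω = 1) :
    (∑ ω, |P ω - Q ω|) ^ 2 ≤ 2 * relEntropy P Q := by
  have hkl : ∑ ω, Q ω * klFun (P ω / Q ω) = relEntropy P Q := by
    have : ∀ ω, Q ω * klFun (P ω / Q ω) = P ω * log (P ω / Q ω) + Q ω - P ω := by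
      intro ω
      by_cases h : Q ω = 0
      · simp [h, hPQ ω h]
      · rw [klFun_apply]
        field_simp
    simp_rw [this, Finset.sum_sub_distrib, Finset.sum_add_distrib, hP1, hQ1, relEntropy]
    ring
  have hmass : ∑ ω, (2 * P ω + 4 * Q ω) / 3 = 2 := by
    rw [← Finset.sum_div, Finset.sum_add_distrib, ← Finset.mul_sum, ← Finset.mul_sum, hP1, hQ1]
    norm_num
  rw [← hkl, ← hmass]
  refine Finset.sum_sq_le_sum_mul_sum_of_sq_le_mul _ (fun ω _ => ?_) (fun ω _ => ?_)
    (fun ω _ => ?_)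
  · have := hP ω
    have := hQ ω
    positivity
  · exact mul_nonneg (hQ ω) (klFun_nonneg (div_nonneg (hP ω) (hQ ω)))
  · by_cases h : Q ω = 0
    · simp [h, hPQ ω h]
    · have h1 := three_mul_sub_one_sq_le_klFun (div_nonneg (hP ω) (hQ ω))
      have h2 := mul_le_mul_of_nonneg_left h1 (sq_nonneg (Q ω))
      have h3 : Q ω ^ 2 * (3 * (P ω / Q ω - 1) ^ 2) = 3 * (P ω - Q ω) ^ 2 := by
        field_simp
      have h4 : Q ω ^ 2 * ((2 * (P ω / Q ω) + 4) * klFun (P ω / Q ω)) =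
          3 * ((2 * P ω + 4 * Q ω) / 3 * (Q ω * klFun (P ω / Q ω))) := by
        field_simp
      rw [h3, h4] at h2
      rw [sq_abs]
      linarith

theorem relEntropy_self {Ω : Type*} [Fintype Ω] (P : Ω → ℝ) : relEntropy P P = 0 := by
  refine Finset.sum_eq_zero fun ω _ => ?_
  by_cases h : P ω = 0 <;> simp [h]

/-- Relative entropy is additive over product laws. -/
theorem relEntropy_prod {ι α : Type*} [Fintype ι] [DecidableEq ι] [Fintype α] {P Q : ι → α → ℝ}
    (hPQ : ∀ i a, Q i a = 0 → P i a = 0) (hP1 : ∀ i, ∑ a, P i a = 1) :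
    relEntropy (fun v : ι → α => ∏ i, P i (v i)) (fun v => ∏ i, Q i (v i)) =
      ∑ i, relEntropy (P i) (Q i) := by
  have h : ∀ v : ι → α, (∏ i, P i (v i)) * log ((∏ i, P i (v i)) / ∏ i, Q i (v i)) =
      ∑ i, (∏ j, P j (v j)) * log (P i (v i) / Q i (v i)) := by
    intro v
    by_cases hv : ∏ i, P i (v i) = 0
    · simp [hv]
    · rw [← Finset.prod_div_distrib, Real.log_prod, Finset.mul_sum]
      intro i hi
      have hPi := (Finset.prod_ne_zero_iff.mp hv) i hi
      exact div_ne_zero hPi fun h0 => hPi (hPQ i _ h0)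
  unfold relEntropy
  simp_rw [h]
  rw [Finset.sum_comm]
  exact Finset.sum_congr rfl fun i _ =>
    sum_prod_mul_apply hP1 i (fun a => log (P i a / Q i a))

end Pinsker

/-! ### Sequential description of a random binary word -/

section Sequential

/-- A product of causal factors sums to the product of the one-step sums. -/
theorem sum_prod_causal {α : Type*} [Fintype α] [Inhabited α] :
    ∀ {n : ℕ} (g : Fin n → (Fin n → α) → ℝ) (c : Fin n → ℝ),
      (∀ j a a', (∀ i ≤ j, a i = a' i) → g j a = g j a') →
      (∀ j a, ∑ b, g j (Function.update a j b) = c j) →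
      ∑ a, ∏ j, g j a = ∏ j, c j
  | 0, g, c, _, _ => by simp
  | n + 1, g, c, hdep, hsum => by
    -- The earlier factors do not see the last letter, so it may be frozen at `default`; the
    -- innermost sum over it then only meets the last factor.
    have ih := sum_prod_causal (n := n)
      (fun j a => g j.castSucc (Fin.snoc (α := fun _ => α) a default))
      (fun j => c j.castSucc)
      (by
        intro j a a' h
        refine hdep _ _ _ fun i hi => ?_
        induction i using Fin.lastCases with
        | last => simp
        | cast i => simpa using h i (by simpa using hi))
      (by
        intro j a
        rw [← hsum j.castSucc (Fin.snoc (α := fun _ => α) a default)]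
        exact Finset.sum_congr rfl fun b _ => by rw [Fin.snoc_update])
    rw [Fin.prod_univ_castSucc, ← ih, ← (Fin.snocEquiv fun _ : Fin (n + 1) => α).sum_comp,
      Fintype.sum_prod_type_right, Finset.sum_mul]
    refine Finset.sum_congr rfl fun a _ => ?_
    rw [← hsum (Fin.last n) (Fin.snoc (α := fun _ => α) a default), Finset.mul_sum]
    refine Finset.sum_congr rfl fun b _ => ?_
    rw [Fin.prod_univ_castSucc]
    congr 1
    · refine Finset.prod_congr rfl fun j _ => hdep _ _ _ fun i hi => ?_
      induction i using Fin.lastCases with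
      | last => exact absurd hi (by simp [Fin.le_def])
      | cast i => simp [Fin.snocEquiv]
    · congr 1
      rw [Fin.update_snoc_last]
      rfl

variable {Ω : Type*} [Fintype Ω] {n : ℕ} (P : Ω → ℝ) (A : Ω → Fin n → ZMod 2)

/-- Probability that the first `k` bits of `A` are those of `a`. -/
def prefixProb (k : ℕ) (a : Fin n → ZMod 2) : ℝ :=
  prob P fun ω => ∀ i : Fin n, i.val < k → A ω i = a i

/-- Conditional entropy of the bit `j` of `A` given the bits before it. -/
def stepEntropy (j : Fin n) : ℝ :=
  -∑ ω, P ω * Real.logb 2 (prefixProb P A (j.val + 1) (A ω) / prefixProb P A j.val (A ω))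

open scoped Classical in
/-- Transition probability to the bit `j`, replaced by a fair coin on `S` and after prefixes of
probability zero. -/
def tiltStep (S : Finset (Fin n)) (j : Fin n) (a : Fin n → ZMod 2) : ℝ :=
  if j ∈ S ∨ prefixProb P A j.val a = 0 then 1 / 2
  else prefixProb P A (j.val + 1) a / prefixProb P A j.val a

/-- The law of a word whose bits in `S` are fair coins, while the other bits follow the conditional
laws of the bits of `A`. -/
def tilt (S : Finset (Fin n)) (a : Fin n → ZMod 2) : ℝ := ∏ j, tiltStep P A S j a

variable {P A}

theorem prefixProb_congr {k : ℕ} {a a' : Fin n → ZMod 2} (h : ∀ i : Fin n, i.val < k → a i = a' i) :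
    prefixProb P A k a = prefixProb P A k a' :=
  prob_congr P fun _ => forall_congr' fun i =>
    ⟨fun h1 hi => (h1 hi).trans (h i hi), fun h1 hi => (h1 hi).trans (h i hi).symm⟩

theorem sum_prefixProb_update (j : Fin n) (a : Fin n → ZMod 2) :
    ∑ b, prefixProb P A (j.val + 1) (Function.update a j b) = prefixProb P A j.val a := by
  unfold prefixProb
  rw [← sum_prob_and P (fun ω => A ω j)]
  refine Finset.sum_congr rfl fun b _ => prob_congr P fun ω => ⟨fun h => ⟨fun i hi => ?_, ?_⟩, ?_⟩
  · have := h i (by omega)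
    rwa [Function.update_of_ne (by rintro rfl; omega)] at this
  · simpa using h j (by omega)
  · rintro ⟨h1, h2⟩ i hi
    by_cases hij : i = j
    · subst hij
      simpa using h2
    · rw [Function.update_of_ne hij]
      exact h1 i (by have := Fin.val_ne_of_ne hij; omega)

theorem prefixProb_zero (hP1 : ∑ ω, P ω = 1) (a : Fin n → ZMod 2) : prefixProb P A 0 a = 1 := by
  rw [← hP1]
  exact prob_of_forall P (by simp)

theorem prefixProb_length (hA : Function.Injective A) (ω : Ω) : prefixProb P A n (A ω) = P ω := by
  classical
  have : prefixProb P A n (A ω) = prob P fun ω' => ω' = ω :=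
    prob_congr P fun ω' => ⟨fun h => hA (funext fun i => h i i.isLt), fun h => by simp [h]⟩
  rw [this]
  simp [prob]

theorem prefixProb_nonneg (hP : ∀ ω, 0 ≤ P ω) (k : ℕ) (a : Fin n → ZMod 2) :
    0 ≤ prefixProb P A k a := prob_nonneg hP _

theorem prefixProb_succ_le (hP : ∀ ω, 0 ≤ P ω) (k : ℕ) (a : Fin n → ZMod 2) :
    prefixProb P A (k + 1) a ≤ prefixProb P A k a :=
  prob_mono hP fun _ h i hi => h i (by omega)

theorem prefixProb_pos (hP : ∀ ω, 0 ≤ P ω) {ω : Ω} (hω : P ω ≠ 0) (k : ℕ) :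
    0 < prefixProb P A k (A ω) :=
  (lt_of_le_of_ne (hP ω) hω.symm).trans_le (le_prob hP fun _ _ => rfl)

theorem tiltStep_congr (S : Finset (Fin n)) (j : Fin n) {a a' : Fin n → ZMod 2}
    (h : ∀ i ≤ j, a i = a' i) : tiltStep P A S j a = tiltStep P A S j a' := by
  unfold tiltStep
  rw [prefixProb_congr (k := j.val) (a' := a') fun i hi => h i (Fin.le_def.2 hi.le),
    prefixProb_congr (k := j.val + 1) (a' := a') fun i hi => h i (Fin.le_def.2 (by omega))]

theorem tiltStep_nonneg (hP : ∀ ω, 0 ≤ P ω) (S : Finset (Fin n)) (j : Fin n)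
    (a : Fin n → ZMod 2) : 0 ≤ tiltStep P A S j a := by
  unfold tiltStep
  split_ifs
  · norm_num
  · exact div_nonneg (prefixProb_nonneg hP _ _) (prefixProb_nonneg hP _ _)

theorem tiltStep_of_mem {S : Finset (Fin n)} {j : Fin n} (hj : j ∈ S) (a : Fin n → ZMod 2) :
    tiltStep P A S j a = 1 / 2 := if_pos (Or.inl hj)

/-- The value 1/2 after null prefixes makes this hold after every prefix, so that the tilted law has
total mass 1. -/
theorem sum_tiltStep_update (S : Finset (Fin n)) (j : Fin n) (a : Fin n → ZMod 2) :
    ∑ b, tiltStep P A S j (Function.update a j b) = 1 := by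
  have h : ∀ b, prefixProb P A j.val (Function.update a j b) = prefixProb P A j.val a := fun b =>
    prefixProb_congr fun i hi => Function.update_of_ne (by rintro rfl; omega) _ _
  unfold tiltStep
  simp_rw [h]
  split_ifs with hc
  · simp [ZMod.card]
  · rw [← Finset.sum_div, sum_prefixProb_update]
    exact div_self fun h0 => hc (Or.inr h0)

theorem tilt_nonneg (hP : ∀ ω, 0 ≤ P ω) (S : Finset (Fin n)) (a : Fin n → ZMod 2) :
    0 ≤ tilt P A S a := Finset.prod_nonneg fun j _ => tiltStep_nonneg hP S j a

/-- Under the tilted law the bits in `S` are uniform. -/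
theorem prob_tilt_eq (S : Finset (Fin n)) (h : Fin n → ZMod 2) :
    prob (tilt P A S) (fun a => ∀ j ∈ S, a j = h j) = (1 / 2) ^ S.card := by
  classical
  -- The event is absorbed into the factors in `S`; the product stays causal, with one-step sums 1/2
  -- on `S` and 1 elsewhere.
  have h1 : ∀ a : Fin n → ZMod 2, (if ∀ j ∈ S, a j = h j then tilt P A S a else 0) =
      ∏ j, (if j ∈ S then (if a j = h j then 1 / 2 else 0) else tiltStep P A S j a) := by
    intro a
    split_ifs with hc
    · refine Finset.prod_congr rfl fun j _ => ?_
      by_cases hj : j ∈ S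
      · simp [hj, hc j hj, tiltStep_of_mem]
      · simp [hj]
    · push Not at hc
      obtain ⟨j, hj, hne⟩ := hc
      exact (Finset.prod_eq_zero (Finset.mem_univ j) (by simp [hj, hne])).symm
  have h2 : prob (tilt P A S) (fun a => ∀ j ∈ S, a j = h j) = ∑ a : Fin n → ZMod 2, ∏ j,
      (if j ∈ S then (if a j = h j then 1 / 2 else 0) else tiltStep P A S j a) :=
    Finset.sum_congr rfl fun a _ => by convert h1 a
  rw [h2, sum_prod_causal _ (fun j => if j ∈ S then 1 / 2 else 1)]
  · rw [Finset.prod_ite_mem]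
    simp
  · intro j a a' haa
    rw [haa j le_rfl, tiltStep_congr S j haa]
  · intro j a
    by_cases hj : j ∈ S
    · simp [hj]
    · simp only [hj, if_false]
      exact sum_tiltStep_update S j a

theorem sum_tilt (S : Finset (Fin n)) : ∑ a, tilt P A S a = 1 := by
  unfold tilt
  rw [sum_prod_causal _ (fun _ => 1) (fun j _ _ h => tiltStep_congr S j h)
    (fun j a => sum_tiltStep_update S j a)]
  simp

theorem tiltStep_pos (hP : ∀ ω, 0 ≤ P ω) (S : Finset (Fin n)) (j : Fin n) {ω : Ω} (hω : P ω ≠ 0) :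
    0 < tiltStep P A S j (A ω) := by
  unfold tiltStep
  split_ifs
  · norm_num
  · exact div_pos (prefixProb_pos hP hω _) (prefixProb_pos hP hω _)

/-- Absolute continuity, as Pinsker's inequality requires: along an outcome of positive probability
every transition probability is positive. -/
theorem eq_zero_of_tilt_eq_zero (hP : ∀ ω, 0 ≤ P ω) (S : Finset (Fin n)) {ω : Ω}
    (h : tilt P A S (A ω) = 0) : P ω = 0 := by
  by_contra hω
  exact (Finset.prod_pos fun j _ => tiltStep_pos hP S j hω).ne' h

/-- The sum telescopes from the empty prefix, of probability 1, to the full word, which determines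
`ω` by injectivity. -/
theorem sum_log_prefixProb_div (hP : ∀ ω, 0 ≤ P ω) (hP1 : ∑ ω, P ω = 1)
    (hA : Function.Injective A) {ω : Ω} (hω : P ω ≠ 0) :
    ∑ j : Fin n, Real.log (prefixProb P A (j.val + 1) (A ω) / prefixProb P A j.val (A ω)) =
      Real.log (P ω) := by
  have h : ∀ j : ℕ, Real.log (prefixProb P A (j + 1) (A ω) / prefixProb P A j (A ω)) =
      Real.log (prefixProb P A (j + 1) (A ω)) - Real.log (prefixProb P A j (A ω)) := fun j =>
    Real.log_div (prefixProb_pos hP hω _).ne' (prefixProb_pos hP hω _).ne'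
  rw [Fin.sum_univ_eq_sum_range
    (fun j => Real.log (prefixProb P A (j + 1) (A ω) / prefixProb P A j (A ω))) n]
  simp_rw [h]
  rw [Finset.sum_range_sub (fun j => Real.log (prefixProb P A j (A ω))), prefixProb_length hA,
    prefixProb_zero hP1]
  simp

/-- Relative entropy to the tilted law. -/
theorem relEntropy_tilt (hP : ∀ ω, 0 ≤ P ω) (hP1 : ∑ ω, P ω = 1) (hA : Function.Injective A)
    (S : Finset (Fin n)) :
    relEntropy P (fun ω => tilt P A S (A ω)) =
      Real.log 2 * ∑ j ∈ S, (1 - stepEntropy P A j) := by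
  have hlog2 : Real.log 2 ≠ 0 := (Real.log_pos one_lt_two).ne'
  -- Off `S` the factors of `tilt` are the chain-rule factors of `P ω` and cancel; on `S` a factor
  -- 1/2 is compared with the true conditional probability.
  have key : ∀ ω, P ω * Real.log (P ω / tilt P A S (A ω)) =
      ∑ j ∈ S, (P ω * Real.log 2 + Real.log 2 * (P ω * Real.logb 2
        (prefixProb P A (j.val + 1) (A ω) / prefixProb P A j.val (A ω)))) := by
    intro ω
    by_cases hω : P ω = 0
    · simp [hω]
    have hpos := fun j => tiltStep_pos (A := A) hP S j hω
    rw [tilt, Real.log_div hω (Finset.prod_pos fun j _ => hpos j).ne',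
      Real.log_prod fun j _ => (hpos j).ne', ← sum_log_prefixProb_div hP hP1 hA hω,
      ← Finset.sum_sub_distrib, Finset.mul_sum, ← Finset.sum_subset (Finset.subset_univ S)]
    · refine Finset.sum_congr rfl fun j hj => ?_
      rw [tiltStep_of_mem hj, Real.logb, one_div, Real.log_inv]
      field_simp
      ring
    · intro j _ hj
      rw [tiltStep, if_neg (by simp [hj, (prefixProb_pos (A := A) hP hω j.val).ne'])]
      simp
  unfold relEntropy stepEntropy
  simp_rw [key]
  rw [Finset.sum_comm, Finset.mul_sum]
  refine Finset.sum_congr rfl fun j _ => ?_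
  rw [Finset.sum_add_distrib, ← Finset.sum_mul, hP1, ← Finset.mul_sum]
  ring

theorem sum_tilt_comp (hA : Function.Bijective A) (S : Finset (Fin n)) :
    ∑ ω, tilt P A S (A ω) = 1 := by
  rw [hA.sum_comp (tilt P A S), sum_tilt]

/-- With `S = {j}` the relative entropy to the tilted law is `log 2 * (1 - stepEntropy P A j)`, and
Pinsker's inequality shows that it is nonnegative. -/
theorem stepEntropy_le_one (hP : ∀ ω, 0 ≤ P ω) (hP1 : ∑ ω, P ω = 1) (hA : Function.Bijective A)
    (j : Fin n) : stepEntropy P A j ≤ 1 := by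
  have h := pinsker hP (fun ω => tilt_nonneg (A := A) hP {j} (A ω))
    (fun ω => eq_zero_of_tilt_eq_zero hP {j}) hP1 (sum_tilt_comp hA {j})
  rw [relEntropy_tilt hP hP1 hA.1, Finset.sum_singleton] at h
  have h2 := (sq_nonneg _).trans h
  have h3 := Real.log_pos one_lt_two
  by_contra hc
  have : Real.log 2 * (1 - stepEntropy P A j) < 0 := mul_neg_of_pos_of_neg h3 (by linarith)
  linarith

theorem stepEntropy_nonneg (hP : ∀ ω, 0 ≤ P ω) (j : Fin n) : 0 ≤ stepEntropy P A j := by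
  unfold stepEntropy
  rw [Left.nonneg_neg_iff]
  refine Finset.sum_nonpos fun ω _ => mul_nonpos_of_nonneg_of_nonpos (hP ω) ?_
  exact Real.logb_nonpos one_lt_two
    (div_nonneg (prefixProb_nonneg hP _ _) (prefixProb_nonneg hP _ _))
    (div_le_one_of_le₀ (prefixProb_succ_le hP _ _) (prefixProb_nonneg hP _ _))

/-- Chain rule for the entropy. -/
theorem sum_stepEntropy (hP : ∀ ω, 0 ≤ P ω) (hP1 : ∑ ω, P ω = 1) (hA : Function.Injective A) :
    ∑ j, stepEntropy P A j = -∑ ω, P ω * Real.logb 2 (P ω) := by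
  unfold stepEntropy
  rw [Finset.sum_neg_distrib, Finset.sum_comm]
  congr 1
  refine Finset.sum_congr rfl fun ω _ => ?_
  by_cases hω : P ω = 0
  · simp [hω]
  · rw [← Finset.mul_sum]
    simp_rw [Real.logb]
    rw [← Finset.sum_div, sum_log_prefixProb_div hP hP1 hA hω]

/-- An event that implies that the bit `j` has conditional probability at most `1 / 2` has at most
the probability `H(A_j | A_0, …, A_{j-1})`. -/
theorem prob_le_stepEntropy (hP : ∀ ω, 0 ≤ P ω) (j : Fin n) (E : Ω → Prop)
    (hE : ∀ ω, E ω → 2 * prefixProb P A (j.val + 1) (A ω) ≤ prefixProb P A j.val (A ω)) :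
    prob P E ≤ stepEntropy P A j := by
  unfold prob stepEntropy
  rw [← Finset.sum_neg_distrib]
  refine Finset.sum_le_sum fun ω _ => ?_
  by_cases hω : P ω = 0
  · simp [hω]
  have h0 := prefixProb_pos (A := A) hP hω j.val
  have h1 := prefixProb_pos (A := A) hP hω (j.val + 1)
  split_ifs with h
  -- An outcome in `E` contributes at least one bit; all others contribute a nonnegative amount.
  · have h2 : prefixProb P A (j.val + 1) (A ω) / prefixProb P A j.val (A ω) ≤ 2⁻¹ := by
      rw [div_le_iff₀ h0]
      linarith [hE ω h]
    have h3 := Real.logb_le_logb_of_le one_lt_two (div_pos h1 h0) h2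
    rw [Real.logb_inv, Real.logb_self_eq_one one_lt_two] at h3
    nlinarith [hP ω]
  · have h3 := Real.logb_nonpos one_lt_two (div_pos h1 h0).le
      (div_le_one_of_le₀ (prefixProb_succ_le hP _ _) h0.le)
    have := mul_nonpos_of_nonneg_of_nonpos (hP ω) h3
    linarith

end Sequential

/-! ### The source and the polarization transform -/

section Source

theorem zmod_two_eq_zero_or_one (x : ZMod 2) : x = 0 ∨ x = 1 := by
  revert x
  decide

theorem sum_zmod_two {M : Type*} [AddCommMonoid M] (f : ZMod 2 → M) : ∑ b, f b = f 0 + f 1 :=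
  Fin.sum_univ_two f

theorem srcProb_nonneg {p : ℝ} (hp0 : 0 ≤ p) (hp1 : p ≤ 1) {n : ℕ} (v : Fin n → ZMod 2) :
    0 ≤ srcProb p v := by
  refine Finset.prod_nonneg fun t _ => ?_
  split_ifs <;> linarith

theorem sum_srcProb (p : ℝ) (n : ℕ) : ∑ v : Fin n → ZMod 2, srcProb p v = 1 := by
  unfold srcProb
  refine sum_prod_eq_one (P := fun (_ : Fin n) (b : ZMod 2) => if b = 1 then p else 1 - p)
    fun _ => ?_
  rw [sum_zmod_two]
  simp

theorem bitRev_bitRev {m : ℕ} (i : Fin (2 ^ m)) : bitRev (bitRev i) = i := by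
  simp [bitRev, bitsOf]

theorem bitRevMatrix_mul_self (m : ℕ) : bitRevMatrix m * bitRevMatrix m = 1 := by
  ext i k
  rw [Matrix.mul_apply, Finset.sum_eq_single (bitRev i)]
  · simp [bitRevMatrix, bitRev_bitRev, Matrix.one_apply, @eq_comm _ k]
  · intro j _ hj
    simp [bitRevMatrix, hj]
  · simp

theorem kernel_mul_self : kernel * kernel = 1 := by
  unfold kernel
  decide

/-- Over the binary digits of the summation index, the matrix product factors into copies of `kernel
* kernel = 1`. -/
theorem kernelPow_mul_self (m : ℕ) : kernelPow m * kernelPow m = 1 := by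
  ext i k
  have h : (kernelPow m * kernelPow m) i k =
      ∑ f : Fin m → Fin 2, ∏ t, kernel (bitsOf i t) (f t) * kernel (f t) (bitsOf k t) := by
    rw [Matrix.mul_apply, ← finFunctionFinEquiv.sum_comp]
    refine Finset.sum_congr rfl fun f _ => ?_
    simp [kernelPow, bitsOf, Finset.prod_mul_distrib]
  rw [h, ← Fintype.prod_sum fun t b => kernel (bitsOf i t) b * kernel b (bitsOf k t)]
  have h2 : ∀ t, ∑ b, kernel (bitsOf i t) b * kernel b (bitsOf k t) =
      if bitsOf i t = bitsOf k t then 1 else 0 := fun t => by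
    rw [← Matrix.mul_apply, kernel_mul_self, Matrix.one_apply]
  simp_rw [h2]
  rw [Matrix.one_apply]
  split_ifs with hik
  · simp [hik]
  · have : bitsOf i ≠ bitsOf k := fun h => hik (finFunctionFinEquiv.symm.injective h)
    obtain ⟨t, ht⟩ := Function.ne_iff.mp this
    exact Finset.prod_eq_zero (Finset.mem_univ t) (if_neg ht)

theorem isUnit_det_polarG (m : ℕ) : IsUnit (polarG m).det := by
  refine Matrix.isUnit_det_of_right_inverse (B := kernelPow m * bitRevMatrix m) ?_
  rw [polarG, Matrix.mul_assoc, ← Matrix.mul_assoc (kernelPow m), kernelPow_mul_self,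
    Matrix.one_mul, bitRevMatrix_mul_self]

theorem vecMul_polarize_inv (m : ℕ) (v : Fin (2 ^ m) → ZMod 2) :
    Matrix.vecMul (polarize m v) (polarG m)⁻¹ = v := by
  rw [polarize, Matrix.vecMul_vecMul, Matrix.mul_nonsing_inv _ (isUnit_det_polarG m),
    Matrix.vecMul_one]

theorem polarize_bijective (m : ℕ) : Function.Bijective (polarize m) :=
  Finite.injective_iff_bijective.mp
    (Function.LeftInverse.injective (g := fun a => Matrix.vecMul a (polarG m)⁻¹)
      (vecMul_polarize_inv m))

theorem bitEntropy_eq_stepEntropy (p : ℝ) (m : ℕ) (j : Fin (2 ^ m)) :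
    bitEntropy p m j = stepEntropy (srcProb p) (polarize m) j := by
  rw [bitEntropy, condEntropy_eq_sum, stepEntropy]
  congr 1
  refine Finset.sum_congr rfl fun v _ => ?_
  have h : ∀ v', ((fun i : Fin j.val => polarize m v' (Fin.castLE j.isLt.le i)) =
      fun i : Fin j.val => polarize m v (Fin.castLE j.isLt.le i)) ↔
      ∀ i : Fin (2 ^ m), i.val < j.val → polarize m v' i = polarize m v i := fun v' =>
    ⟨fun h i hi => congrFun h ⟨i.val, hi⟩, fun h => funext fun i => h _ i.isLt⟩
  congr 3
  · refine prob_congr _ fun v' => ?_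
    rw [h]
    refine ⟨fun ⟨h1, h2⟩ i hi => ?_, fun h1 => ⟨h1 j (by omega), fun i hi => h1 i (by omega)⟩⟩
    by_cases hij : i = j
    · rw [hij, h1]
    · exact h2 i (by have := Fin.val_ne_of_ne hij; omega)
  · exact prob_congr _ h

theorem bitEntropy_le_one {p : ℝ} (hp0 : 0 ≤ p) (hp1 : p ≤ 1) {m : ℕ} (j : Fin (2 ^ m)) :
    bitEntropy p m j ≤ 1 := by
  rw [bitEntropy_eq_stepEntropy]
  exact stepEntropy_le_one (srcProb_nonneg hp0 hp1) (sum_srcProb p _) (polarize_bijective m) j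

theorem bitEntropy_nonneg {p : ℝ} (hp0 : 0 ≤ p) (hp1 : p ≤ 1) {m : ℕ} (j : Fin (2 ^ m)) :
    0 ≤ bitEntropy p m j := by
  rw [bitEntropy_eq_stepEntropy]
  exact stepEntropy_nonneg (srcProb_nonneg hp0 hp1) j

theorem sum_bitEntropy {p : ℝ} (hp0 : 0 ≤ p) (hp1 : p ≤ 1) (m : ℕ) :
    ∑ j, bitEntropy p m j =
      -∑ v : Fin (2 ^ m) → ZMod 2, srcProb p v * Real.logb 2 (srcProb p v) := by
  simp_rw [bitEntropy_eq_stepEntropy]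
  exact sum_stepEntropy (srcProb_nonneg hp0 hp1) (sum_srcProb p _) (polarize_bijective m).1

end Source

/-! ### Reliability of successive cancellation -/

section Reliability

variable {p β : ℝ} {m d : ℕ}

theorem mapBit_congr {j : Fin (2 ^ m)} {a a' : Fin (2 ^ m) → ZMod 2} (h : ∀ i < j, a i = a' i) :
    mapBit p m j a = mapBit p m j a' := by
  have h1 : ∀ b, prob (srcProb p) (fun v => (∀ i < j, polarize m v i = a i) ∧ polarize m v j = b) =
      prob (srcProb p) (fun v => (∀ i < j, polarize m v i = a' i) ∧ polarize m v j = b) := fun b =>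
    prob_congr _ fun v => and_congr_left fun _ => forall₂_congr fun i hi => by rw [h i hi]
  unfold mapBit
  rw [h1, h1]

/-- Successive cancellation succeeds when all the single decisions from the true past do. -/
theorem scDecode_eq {a known : Fin (2 ^ m) → ZMod 2} (hknown : ∀ j ∉ setU p β m, known j = a j)
    (hmap : ∀ j ∈ setU p β m, mapBit p m j a = a j) (j : Fin (2 ^ m)) :
    scDecode p β m known j = a j := by
  induction j using WellFoundedLT.induction with
  | _ j ih =>
    rw [scDecode]
    split_ifs with hj
    · rw [← hmap j hj]
      refine mapBit_congr fun i hi => ?_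
      rw [dif_pos (Fin.lt_def.1 hi), ih i hi]
    · exact hknown j hj

/-- The seed is added twice and cancels in characteristic 2; `hd` ensures that every index in `J_V`
has a seed bit. -/
theorem knownBits_srcEncode (hd : (setJ p β m).card ≤ d) (v : Fin (2 ^ m) → ZMod 2)
    (u : Fin d → ZMod 2) {j : Fin (2 ^ m)} (hj : j ∉ setU p β m) :
    knownBits p β m d (srcEncode p β m d v u) u j = polarize m v j := by
  unfold knownBits
  split_ifs with hH hJ h
  · unfold srcEncode
    rw [Fin.append_left, ← Finset.coe_orderIsoOfFin_apply, OrderIso.apply_symm_apply]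
  · have h1 := (((setJ p β m).orderIsoOfFin rfl).symm ⟨j, hJ⟩).isLt
    unfold srcEncode
    rw [Fin.append_right, dif_pos h1, add_assoc, CharTwo.add_self_eq_zero, add_zero]
    congr 1
    rw [← Finset.coe_orderIsoOfFin_apply, Fin.eta, OrderIso.apply_symm_apply]
  · exact absurd ((((setJ p β m).orderIsoOfFin rfl).symm ⟨j, hJ⟩).isLt.trans_le hd) h
  · exact absurd (by simp [setJ, hj, hH]) hJ

theorem srcDecode_srcEncode (hd : (setJ p β m).card ≤ d) {v : Fin (2 ^ m) → ZMod 2}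
    (u : Fin d → ZMod 2)
    (h : ∀ j ∈ setU p β m, mapBit p m j (polarize m v) = polarize m v j) :
    srcDecode p β m d (srcEncode p β m d v u) u = v := by
  rw [srcDecode, show scDecode p β m _ = polarize m v from
    funext (scDecode_eq (fun j hj => knownBits_srcEncode hd v u hj) h), vecMul_polarize_inv]

/-- The error probability of a maximum a posteriori decision is at most the conditional entropy. -/
theorem prob_mapBit_ne_le (hp0 : 0 ≤ p) (hp1 : p ≤ 1) (j : Fin (2 ^ m)) :
    prob (srcProb p) (fun v => mapBit p m j (polarize m v) ≠ polarize m v j) ≤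
      bitEntropy p m j := by
  rw [bitEntropy_eq_stepEntropy]
  refine prob_le_stepEntropy (srcProb_nonneg hp0 hp1) j _ fun v hv => ?_
  set a := polarize m v with ha
  have h1 : ∀ b, prob (srcProb p)
      (fun v => (∀ i < j, polarize m v i = a i) ∧ polarize m v j = b) =
      prefixProb (srcProb p) (polarize m) (j.val + 1) (Function.update a j b) := by
    intro b
    refine prob_congr _ fun v' => ⟨fun ⟨h1, h2⟩ i hi => ?_, fun h => ⟨fun i hi => ?_, ?_⟩⟩
    · by_cases hij : i = j
      · subst hij
        simpa using h2
      · rw [Function.update_of_ne hij]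
        exact h1 i (Fin.lt_def.2 (by have := Fin.val_ne_of_ne hij; omega))
    · have := h i (by have := Fin.lt_def.1 hi; omega)
      rwa [Function.update_of_ne hi.ne] at this
    · simpa using h j (by omega)
  have h2 := sum_prefixProb_update (P := srcProb p) (A := polarize m) j a
  rw [sum_zmod_two] at h2
  have h3 : prefixProb (srcProb p) (polarize m) (j.val + 1) a =
      prefixProb (srcProb p) (polarize m) (j.val + 1) (Function.update a j (a j)) := by
    rw [Function.update_eq_self]
  unfold mapBit at hv
  rw [h1, h1] at hv
  rw [h3, ← h2]
  -- If the decision differs from the true bit, the branch of the true bit has at most the mass of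
  -- the other, hence at most half of their sum. Only a weak inequality is needed, so the tie rule
  -- is harmless.
  rcases zmod_two_eq_zero_or_one (a j) with h | h
  · rw [h] at hv ⊢
    split_ifs at hv with hc
    · exact absurd rfl hv
    · linarith
  · rw [h] at hv ⊢
    split_ifs at hv with hc
    · linarith
    · exact absurd rfl hv

end Reliability

/-! ### Grouping of bits into symbols -/

section Symbols

variable {N μ : ℕ} (φ : (Fin μ → ZMod 2) ≃ₗ[ZMod 2] GaloisField 2 μ)

theorem fromSymbols_toSymbols (hμ : 0 < μ) (M : Fin N → ZMod 2)
    (r : Fin (fillLen N μ) → ZMod 2) : fromSymbols φ (toSymbols φ M r) = M := by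
  funext t
  have h : t.val / μ * μ + t.val % μ = t.val := by
    rw [Nat.mul_comm]; exact Nat.div_add_mod _ _
  simp only [fromSymbols, toSymbols, dif_pos hμ, LinearEquiv.symm_apply_apply, h, t.isLt, dif_pos]

theorem length_add_fillLen (hμ : 0 < μ) : N + fillLen N μ = symCount N μ * μ := by
  have h : N ≤ symCount N μ * μ := by
    have := (ceilDiv_le_iff_le_mul hμ).1 (le_refl (N ⌈/⌉ μ))
    rwa [Nat.mul_comm] at this
  unfold fillLen
  omega

/-- Message bits are recovered by `fromSymbols`, fill bit `k` sits at position `N + k`, and both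
sides have `2 ^ (symCount N μ * μ)` elements. This turns uniform bits into uniform symbols. -/
theorem toSymbols_bijective (hμ : 0 < μ) :
    Function.Bijective fun x : (Fin N → ZMod 2) × (Fin (fillLen N μ) → ZMod 2) =>
      toSymbols φ x.1 x.2 := by
  refine (Fintype.bijective_iff_injective_and_card _).2 ⟨?_, ?_⟩
  · rintro ⟨M, r⟩ ⟨M', r'⟩ h
    have hM : M = M' := by
      have := congrArg (fromSymbols φ) h
      simpa only [fromSymbols_toSymbols φ hμ] using this
    subst hM
    simp only [Prod.mk.injEq, true_and]
    funext k
    have hk : N + k.val < symCount N μ * μ := by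
      have := k.isLt
      have := length_add_fillLen (N := N) hμ
      omega
    have hs : (N + k.val) / μ < symCount N μ := (Nat.div_lt_iff_lt_mul hμ).2 hk
    have h1 := congrFun (φ.injective (congrFun h ⟨(N + k.val) / μ, hs⟩))
      ⟨(N + k.val) % μ, Nat.mod_lt _ hμ⟩
    have h2 : (N + k.val) / μ * μ + (N + k.val) % μ = N + k.val := by
      rw [Nat.mul_comm]; exact Nat.div_add_mod _ _
    simpa [h2] using h1
  · have hF : Fintype.card (GaloisField 2 μ) = 2 ^ μ := by
      rw [← Nat.card_eq_fintype_card, GaloisField.card 2 μ hμ.ne']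
    simp only [Fintype.card_prod, Fintype.card_pi, ZMod.card, Finset.prod_const, Finset.card_univ,
      Fintype.card_fin, hF]
    rw [← pow_add, length_add_fillLen hμ, ← pow_mul, Nat.mul_comm]

end Symbols

/-! ### The joint law of the scheme -/

section JointLaw

variable {p β : ℝ} {m ℓ μ d : ℕ}

/-- The joint law of the scheme when message `i` has the law `f i`. -/
def lawOf (β : ℝ) (ℓ μ d : ℕ) (p : ℝ) {m : ℕ} (f : Fin ℓ → (Fin (2 ^ m) → ZMod 2) → ℝ)
    (ω : Outcome p β m ℓ μ d) : ℝ :=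
  (∏ i, f i (ω.1 i)) *
    (Fintype.card (Fin ℓ → Fin d → ZMod 2) : ℝ)⁻¹ *
    (Fintype.card (Fin ℓ → Fin (fillLen (compLen p β m d) μ) → ZMod 2) : ℝ)⁻¹

theorem law_eq_lawOf : law p β m ℓ μ d = lawOf β ℓ μ d p fun _ => srcProb p := rfl

theorem sum_lawOf_mul (f : Fin ℓ → (Fin (2 ^ m) → ZMod 2) → ℝ)
    (g : (Fin ℓ → Fin (2 ^ m) → ZMod 2) → ℝ) :
    ∑ ω : Outcome p β m ℓ μ d, lawOf β ℓ μ d p f ω * g ω.1 = ∑ v, (∏ i, f i (v i)) * g v := by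
  rw [Fintype.sum_prod_type]
  refine Finset.sum_congr rfl fun v _ => ?_
  simp only [lawOf, Finset.sum_const, Finset.card_univ, nsmul_eq_mul, Fintype.card_prod]
  have h1 : (Fintype.card (Fin ℓ → Fin d → ZMod 2) : ℝ) ≠ 0 :=
    Nat.cast_ne_zero.2 Fintype.card_ne_zero
  have h2 : (Fintype.card (Fin ℓ → Fin (fillLen (compLen p β m d) μ) → ZMod 2) : ℝ) ≠ 0 :=
    Nat.cast_ne_zero.2 Fintype.card_ne_zero
  push_cast
  field_simp

theorem lawOf_nonneg {f : Fin ℓ → (Fin (2 ^ m) → ZMod 2) → ℝ} (hf : ∀ i v, 0 ≤ f i v)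
    (ω : Outcome p β m ℓ μ d) : 0 ≤ lawOf β ℓ μ d p f ω := by
  have := Finset.prod_nonneg fun i (_ : i ∈ Finset.univ) => hf i (ω.1 i)
  unfold lawOf
  positivity

theorem sum_lawOf {f : Fin ℓ → (Fin (2 ^ m) → ZMod 2) → ℝ} (hf : ∀ i, ∑ v, f i v = 1) :
    ∑ ω : Outcome p β m ℓ μ d, lawOf β ℓ μ d p f ω = 1 := by
  have := sum_lawOf_mul (p := p) (β := β) (μ := μ) (d := d) f fun _ => 1
  simp only [mul_one] at this
  rw [this, sum_prod_eq_one hf]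

/-- Both laws share the uniform factor of the seeds and fill bits, which sums to 1. -/
theorem sum_abs_lawOf_sub (f g : Fin ℓ → (Fin (2 ^ m) → ZMod 2) → ℝ) :
    ∑ ω : Outcome p β m ℓ μ d, |lawOf β ℓ μ d p f ω - lawOf β ℓ μ d p g ω| =
      ∑ v : Fin ℓ → Fin (2 ^ m) → ZMod 2, |∏ i, f i (v i) - ∏ i, g i (v i)| := by
  rw [Fintype.sum_prod_type]
  refine Finset.sum_congr rfl fun v _ => ?_
  simp only [lawOf, ← sub_mul, abs_mul, abs_inv, Nat.abs_cast, Finset.sum_const, Finset.card_univ,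
    nsmul_eq_mul, Fintype.card_prod]
  have h1 : (Fintype.card (Fin ℓ → Fin d → ZMod 2) : ℝ) ≠ 0 :=
    Nat.cast_ne_zero.2 Fintype.card_ne_zero
  have h2 : (Fintype.card (Fin ℓ → Fin (fillLen (compLen p β m d) μ) → ZMod 2) : ℝ) ≠ 0 :=
    Nat.cast_ne_zero.2 Fintype.card_ne_zero
  push_cast
  field_simp

/-- Probability of an event that concerns one source message. -/
theorem prob_law_apply (p : ℝ) (i : Fin ℓ) (E : (Fin (2 ^ m) → ZMod 2) → Prop) :
    prob (law p β m ℓ μ d) (fun ω => E (ω.1 i)) = prob (srcProb p) E := by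
  classical
  have h := sum_lawOf_mul (p := p) (β := β) (μ := μ) (d := d)
    (fun _ : Fin ℓ => srcProb (n := 2 ^ m) p)
    (fun v => if E (v i) then 1 else 0)
  rw [sum_prod_mul_apply (fun _ => sum_srcProb p _) i (fun v => if E v then 1 else 0)] at h
  unfold prob
  rw [law_eq_lawOf]
  simp only [mul_ite, mul_one, mul_zero] at h
  convert h

/-- The probability that Bob does not recover all the messages. -/
theorem errorProb_le_sum_bitEntropy (hp0 : 0 ≤ p) (hp1 : p ≤ 1) (hμ : 0 < μ)
    (φ : (Fin μ → ZMod 2) ≃ₗ[ZMod 2] GaloisField 2 μ)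
    (G : Matrix (Fin ℓ) (Fin ℓ) (GaloisField 2 μ)) (hd : (setJ p β m).card ≤ d)
    (hG : IsUnit G.det) :
    errorProb p β m ℓ μ d φ G ≤ ℓ * ∑ j ∈ setU p β m, bitEntropy p m j := by
  have hnn : ∀ ω, 0 ≤ law p β m ℓ μ d ω := lawOf_nonneg fun _ => srcProb_nonneg hp0 hp1
  calc errorProb p β m ℓ μ d φ G
      ≤ prob (law p β m ℓ μ d) (fun ω => ∃ i ∈ Finset.univ,
          ∃ j ∈ setU p β m, mapBit p m j (polarize m (ω.1 i)) ≠ polarize m (ω.1 i) j) := by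
        refine prob_mono hnn fun ω hω => ?_
        contrapose! hω
        funext i
        rw [decode, codeword, ← Matrix.mul_assoc,
          Matrix.nonsing_inv_mul _ (by rwa [Matrix.det_transpose]), Matrix.one_mul]
        change srcDecode p β m d (fromSymbols φ (toSymbols φ _ _)) _ = _
        rw [fromSymbols_toSymbols φ hμ]
        exact srcDecode_srcEncode hd _ (hω i (Finset.mem_univ i))
    _ ≤ ∑ i : Fin ℓ, prob (law p β m ℓ μ d) (fun ω => ∃ j ∈ setU p β m,
          mapBit p m j (polarize m (ω.1 i)) ≠ polarize m (ω.1 i) j) :=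
        prob_exists_le hnn _ _
    _ ≤ ∑ i : Fin ℓ, ∑ j ∈ setU p β m, bitEntropy p m j := by
        refine Finset.sum_le_sum fun i _ => (prob_exists_le hnn _ _).trans ?_
        refine Finset.sum_le_sum fun j _ => ?_
        rw [prob_law_apply p i fun v => mapBit p m j (polarize m v) ≠ polarize m v j]
        exact prob_mapBit_ne_le hp0 hp1 j
    _ = _ := by simp

end JointLaw

/-! ### Secrecy -/

section Secrecy

open scoped Classical

/-- Data processing: the triangle inequality on each fibre of `f`. -/
theorem sum_abs_prob_sub_le {Ω α : Type*} [Fintype Ω] [Fintype α] (P Q : Ω → ℝ) (f : Ω → α) :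
    ∑ z, |prob P (fun ω => f ω = z) - prob Q (fun ω => f ω = z)| ≤ ∑ ω, |P ω - Q ω| := by
  rw [← sum_prob_eq (fun ω => |P ω - Q ω|) f]
  refine Finset.sum_le_sum fun z _ => ?_
  unfold prob
  rw [← Finset.sum_sub_distrib]
  refine (Finset.abs_sum_le_sum_abs _ _).trans (Finset.sum_le_sum fun ω _ => ?_)
  split_ifs <;> simp

/-- A homomorphic observation of independent group elements is uniform if the uniform ones among
them already suffice to produce every observation. -/
theorem prob_prod_eq_inv_card {ι X Y : Type*} [Fintype ι] [DecidableEq ι] [AddCommGroup X]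
    [Fintype X] [AddCommGroup Y] [Fintype Y] (ν : ι → X → ℝ) (K : Finset ι)
    (hν : ∀ i ∉ K, ∀ x x', ν i x = ν i x') (hν1 : ∀ i, ∑ x, ν i x = 1)
    (Z : (ι → X) →+ Y) (hZ : ∀ y, ∃ t : ι → X, (∀ i ∈ K, t i = 0) ∧ Z t = y) (y : Y) :
    prob (fun x : ι → X => ∏ i, ν i (x i)) (fun x => Z x = y) = (Fintype.card Y : ℝ)⁻¹ := by
  set π : (ι → X) → ℝ := fun x => ∏ i, ν i (x i) with hπ
  -- A translation `t` supported on the uniform coordinates preserves the law and carries the fibre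
  -- over `y'` to the fibre over `y`.
  have hconst : ∀ y', prob π (fun x => Z x = y') = prob π (fun x => Z x = y) := by
    intro y'
    obtain ⟨t, ht, hty⟩ := hZ (y - y')
    unfold prob
    rw [← Equiv.sum_comp (Equiv.addRight t) (fun x => if Z x = y then π x else 0)]
    refine Finset.sum_congr rfl fun x _ => ?_
    have h1 : π (x + t) = π x := Finset.prod_congr rfl fun i _ => by
      by_cases hi : i ∈ K
      · simp [ht i hi]
      · exact hν i hi _ _
    have h2 : Z (x + t) = y ↔ Z x = y' := by
      rw [map_add, hty]
      constructor
      · intro h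
        rw [← sub_eq_zero, ← sub_eq_zero.2 h]
        abel
      · rintro rfl
        abel
    simp only [Equiv.coe_addRight, h1, h2]
  have hsum := sum_prob_eq π Z
  rw [hπ, sum_prod_eq_one hν1, ← hπ] at hsum
  simp_rw [hconst] at hsum
  rw [Finset.sum_const, Finset.card_univ, nsmul_eq_mul] at hsum
  exact eq_inv_of_mul_eq_one_right hsum

variable {p β : ℝ} {m ℓ μ d : ℕ}

/-- The data of one message: source block, seed and fill bits. -/
abbrev MsgData (p β : ℝ) (m μ d : ℕ) : Type :=
  (Fin (2 ^ m) → ZMod 2) × (Fin d → ZMod 2) × (Fin (fillLen (compLen p β m d) μ) → ZMod 2)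

/-- The law of the data of one message whose source block has the law `f`. -/
def msgLaw (f : (Fin (2 ^ m) → ZMod 2) → ℝ) (b : MsgData p β m μ d) : ℝ :=
  f b.1 * ((Fintype.card (Fin d → ZMod 2) : ℝ)⁻¹ *
    (Fintype.card (Fin (fillLen (compLen p β m d) μ) → ZMod 2) : ℝ)⁻¹)

/-- The symbols of one message. -/
def msgSymbols (φ : (Fin μ → ZMod 2) ≃ₗ[ZMod 2] GaloisField 2 μ) (b : MsgData p β m μ d) :
    Fin (symCount (compLen p β m d) μ) → GaloisField 2 μ :=
  toSymbols φ (srcEncode p β m d b.1 b.2.1) b.2.2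

/-- Outcomes regrouped message by message. -/
def outcomeEquiv (p β : ℝ) (m ℓ μ d : ℕ) :
    (Fin ℓ → MsgData p β m μ d) ≃ Outcome p β m ℓ μ d where
  toFun b := (fun i => (b i).1, fun i => (b i).2.1, fun i => (b i).2.2)
  invFun ω i := (ω.1 i, ω.2.1 i, ω.2.2 i)
  left_inv _ := rfl
  right_inv _ := rfl

theorem lawOf_outcomeEquiv (f : Fin ℓ → (Fin (2 ^ m) → ZMod 2) → ℝ)
    (b : Fin ℓ → MsgData p β m μ d) :
    lawOf β ℓ μ d p f (outcomeEquiv p β m ℓ μ d b) = ∏ i, msgLaw (f i) (b i) := by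
  simp [lawOf, msgLaw, outcomeEquiv, Finset.prod_mul_distrib, mul_assoc, mul_pow]

theorem sum_msgLaw (f : (Fin (2 ^ m) → ZMod 2) → ℝ) :
    ∑ b : MsgData p β m μ d, msgLaw f b = ∑ v, f v := by
  rw [Fintype.sum_prod_type]
  refine Finset.sum_congr rfl fun v _ => ?_
  have h1 : (Fintype.card (Fin d → ZMod 2) : ℝ) ≠ 0 :=
    Nat.cast_ne_zero.2 Fintype.card_ne_zero
  have h2 : (Fintype.card (Fin (fillLen (compLen p β m d) μ) → ZMod 2) : ℝ) ≠ 0 :=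
    Nat.cast_ne_zero.2 Fintype.card_ne_zero
  simp only [msgLaw, Finset.sum_const, Finset.card_univ, nsmul_eq_mul, Fintype.card_prod]
  push_cast
  field_simp

/-- The source law with the bits of `A` in `H_V` replaced by fair coins. -/
def tiltedSrc (p β : ℝ) (m : ℕ) (v : Fin (2 ^ m) → ZMod 2) : ℝ :=
  tilt (srcProb p) (polarize m) (setH p β m) (polarize m v)

theorem sum_tiltedSrc (p β : ℝ) (m : ℕ) : ∑ v, tiltedSrc p β m v = 1 :=
  sum_tilt_comp (polarize_bijective m) _

theorem tiltedSrc_nonneg (hp0 : 0 ≤ p) (hp1 : p ≤ 1) (v : Fin (2 ^ m) → ZMod 2) :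
    0 ≤ tiltedSrc p β m v := tilt_nonneg (srcProb_nonneg hp0 hp1) _ _

/-- The one-time pad: once the bits in `H_V` match, each source block admits exactly one seed
producing `M`. -/
theorem srcEncode_eq_iff (v : Fin (2 ^ m) → ZMod 2) (u : Fin d → ZMod 2)
    (M : Fin (compLen p β m d) → ZMod 2) (h : Fin (2 ^ m) → ZMod 2)
    (hM : ∀ i, h ((setH p β m).orderEmbOfFin rfl i) = M (Fin.castAdd d i)) :
    srcEncode p β m d v u = M ↔ (∀ j ∈ setH p β m, polarize m v j = h j) ∧
      u = fun i => M (Fin.natAdd (setH p β m).card i) - (if h : i.val < (setJ p β m).card then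
        polarize m v ((setJ p β m).orderEmbOfFin rfl ⟨i.val, h⟩) else 0) := by
  constructor
  · rintro rfl
    refine ⟨fun j hj => ?_, funext fun i => ?_⟩
    · obtain ⟨i, rfl⟩ : ∃ i, (setH p β m).orderEmbOfFin rfl i = j := by
        have : j ∈ Set.range ((setH p β m).orderEmbOfFin rfl) := by
          rw [Finset.range_orderEmbOfFin]
          exact hj
        exact this
      rw [hM, srcEncode, Fin.append_left]
    · rw [srcEncode, Fin.append_right, add_sub_cancel_left]
  · rintro ⟨h1, rfl⟩
    funext t
    refine Fin.addCases (fun i => ?_) (fun i => ?_) t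
    · rw [srcEncode, Fin.append_left, h1 _ (Finset.orderEmbOfFin_mem _ rfl i), hM]
    · rw [srcEncode, Fin.append_right, add_sub_cancel]

/-- Under the tilted source law the symbols of a message are uniform. -/
theorem prob_msgSymbols_const (hμ : 0 < μ) (φ : (Fin μ → ZMod 2) ≃ₗ[ZMod 2] GaloisField 2 μ)
    (x : Fin (symCount (compLen p β m d) μ) → GaloisField 2 μ) :
    prob (msgLaw (μ := μ) (d := d) (tiltedSrc p β m)) (fun b => msgSymbols φ b = x) =
      (1 / 2) ^ (setH p β m).card * ((Fintype.card (Fin d → ZMod 2) : ℝ)⁻¹ *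
    (Fintype.card (Fin (fillLen (compLen p β m d) μ) → ZMod 2) : ℝ)⁻¹) := by
  obtain ⟨⟨M, r⟩, hx⟩ := (toSymbols_bijective (N := compLen p β m d) φ hμ).2 x
  -- The first part of `M` prescribes `h` on `H_V`; its values elsewhere are never used.
  obtain ⟨h, hM⟩ : ∃ h : Fin (2 ^ m) → ZMod 2,
      ∀ i, h ((setH p β m).orderEmbOfFin rfl i) = M (Fin.castAdd d i) :=
    ⟨Function.extend ((setH p β m).orderEmbOfFin rfl) (fun i => M (Fin.castAdd d i)) 0,
      ((setH p β m).orderEmbOfFin rfl).injective.extend_apply _ _⟩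
  obtain ⟨u₀, hu₀⟩ : ∃ u₀ : (Fin (2 ^ m) → ZMod 2) → Fin d → ZMod 2, ∀ v u,
      srcEncode p β m d v u = M ↔ (∀ j ∈ setH p β m, polarize m v j = h j) ∧ u = u₀ v :=
    ⟨_, fun v u => srcEncode_eq_iff v u M h hM⟩
  have hiff : ∀ b : MsgData p β m μ d, msgSymbols φ b = x ↔
      (∀ j ∈ setH p β m, polarize m b.1 j = h j) ∧ b.2.1 = u₀ b.1 ∧ b.2.2 = r := by
    intro b
    have h1 := (toSymbols_bijective φ hμ).1.eq_iff
      (a := (srcEncode p β m d b.1 b.2.1, b.2.2)) (b := (M, r))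
    rw [← and_assoc, ← hu₀, ← Prod.mk.injEq, ← h1]
    exact Eq.congr_right hx.symm
  have htilt : prob (tilt (srcProb p) (polarize m) (setH p β m))
      (fun a => ∀ j ∈ setH p β m, a j = h j) =
      ∑ v, if ∀ j ∈ setH p β m, polarize m v j = h j then tiltedSrc p β m v else 0 := by
    rw [prob_eq_sum]
    exact ((polarize_bijective m).sum_comp fun a =>
      if ∀ j ∈ setH p β m, a j = h j then tilt (srcProb p) (polarize m) (setH p β m) a else 0).symm
  -- Each block with the right bits in `H_V` has one seed and one fill word, so the sum reduces to
  -- the tilted probability of those bits, `(1/2) ^ |H_V|`.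
  rw [prob_congr _ hiff, ← prob_tilt_eq (P := srcProb p) (A := polarize m) (setH p β m) h, htilt]
  unfold prob
  rw [Fintype.sum_prod_type, Finset.sum_mul]
  refine Finset.sum_congr rfl fun v _ => ?_
  rw [Fintype.sum_prod_type]
  by_cases hv : ∀ j ∈ setH p β m, polarize m v j = h j
  · rw [if_pos hv, Finset.sum_eq_single (u₀ v), Finset.sum_eq_single r]
    · rw [if_pos ⟨hv, rfl, rfl⟩, msgLaw]
    · exact fun r' _ hr => if_neg fun hc => hr hc.2.2
    · simp
    · exact fun u _ hu => Finset.sum_eq_zero fun r' _ => if_neg fun hc => hu hc.2.1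
    · simp
  · rw [if_neg hv, zero_mul]
    exact Finset.sum_eq_zero fun u _ => Finset.sum_eq_zero fun r' _ => if_neg fun hc => hv hc.1

/-- The observation of the eavesdropper as a function of the symbols of the messages. -/
def observe (G : Matrix (Fin ℓ) (Fin ℓ) (GaloisField 2 μ)) (W : Finset (Fin ℓ)) (S : ℕ) :
    (Fin ℓ → Fin S → GaloisField 2 μ) →+ (W → Fin S → GaloisField 2 μ) where
  toFun x i s := ∑ k, G k i * x k s
  map_zero' := by ext; simp
  map_add' x y := by ext; simp [mul_add, Finset.sum_add_distrib]

/-- The messages outside `Ks` can produce every observation on the links in `W`. -/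
def MixesOnto (G : Matrix (Fin ℓ) (Fin ℓ) (GaloisField 2 μ)) (W Ks : Finset (Fin ℓ)) : Prop :=
  ∀ y : W → GaloisField 2 μ, ∃ c : Fin ℓ → GaloisField 2 μ,
    (∀ k ∈ Ks, c k = 0) ∧ ∀ i : W, ∑ k, G k i * c k = y i

/-- The observation depends on the data only through the symbol vectors of the messages, which are
independent, and is additive in them. -/
theorem prob_eveObs (f : Fin ℓ → (Fin (2 ^ m) → ZMod 2) → ℝ)
    (φ : (Fin μ → ZMod 2) ≃ₗ[ZMod 2] GaloisField 2 μ)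
    (G : Matrix (Fin ℓ) (Fin ℓ) (GaloisField 2 μ)) (W : Finset (Fin ℓ))
    (z : W → Fin (symCount (compLen p β m d) μ) → GaloisField 2 μ) :
    prob (lawOf β ℓ μ d p f) (fun ω => eveObs p β m ℓ μ d φ G W ω = z) =
      prob (fun x => ∏ i, prob (msgLaw (μ := μ) (d := d) (p := p) (β := β) (f i))
        (fun b => msgSymbols φ b = x i))
        (fun x => observe G W _ x = z) := by
  have h := sum_prod_mul_comp
    (fun i : Fin ℓ => msgLaw (μ := μ) (d := d) (p := p) (β := β) (f i)) (msgSymbols φ)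
    (fun x => if observe G W _ x = z then 1 else 0)
  simp only [mul_ite, mul_one, mul_zero] at h
  rw [prob_eq_sum, prob_eq_sum]
  refine Eq.trans ?_ h
  rw [← (outcomeEquiv p β m ℓ μ d).sum_comp]
  refine Finset.sum_congr rfl fun b _ => ?_
  rw [lawOf_outcomeEquiv]
  rfl

/-- Outside `Ks` all symbol vectors are equally likely, and `MixesOnto`, applied column by column,
says that these messages alone reach every observation. -/
theorem prob_eveObs_tilted (hμ : 0 < μ) {f : Fin ℓ → (Fin (2 ^ m) → ZMod 2) → ℝ}
    (hf1 : ∀ i, ∑ v, f i v = 1) (Ks : Finset (Fin ℓ)) (hf : ∀ i ∉ Ks, f i = tiltedSrc p β m)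
    (φ : (Fin μ → ZMod 2) ≃ₗ[ZMod 2] GaloisField 2 μ)
    (G : Matrix (Fin ℓ) (Fin ℓ) (GaloisField 2 μ)) (W : Finset (Fin ℓ)) (hG : MixesOnto G W Ks)
    (z : W → Fin (symCount (compLen p β m d) μ) → GaloisField 2 μ) :
    prob (lawOf β ℓ μ d p f) (fun ω => eveObs p β m ℓ μ d φ G W ω = z) =
      (Fintype.card (W → Fin (symCount (compLen p β m d) μ) → GaloisField 2 μ) : ℝ)⁻¹ := by
  rw [prob_eveObs]
  refine prob_prod_eq_inv_card (fun i x => prob (msgLaw (μ := μ) (d := d) (p := p) (β := β) (f i))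
        (fun b => msgSymbols φ b = x)) Ks ?_ ?_ _ ?_ z
  · intro i hi x x'
    simp only [hf i hi]
    rw [prob_msgSymbols_const hμ, prob_msgSymbols_const hμ]
  · intro i
    rw [sum_prob_eq, sum_msgLaw, hf1]
  · intro y
    choose c hc0 hc using fun s => hG fun i => y i s
    refine ⟨fun k s => c s k, fun k hk => funext fun s => hc0 s k hk, ?_⟩
    ext i s
    exact hc s i

/-- Each index in `H_V` lacks less than `δ_n` of a full bit; the factor `log 2 < 1` is discarded. -/
theorem relEntropy_tiltedSrc_le (hp0 : 0 ≤ p) (hp1 : p ≤ 1) :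
    relEntropy (srcProb p) (tiltedSrc p β m) ≤ (setH p β m).card * delta β m := by
  unfold tiltedSrc
  rw [relEntropy_tilt (srcProb_nonneg hp0 hp1) (sum_srcProb p _) (polarize_bijective m).1]
  have h1 : ∑ j ∈ setH p β m, (1 - stepEntropy (srcProb p) (polarize m) j) ≤
      (setH p β m).card * delta β m := by
    rw [← nsmul_eq_mul]
    refine Finset.sum_le_card_nsmul _ _ _ fun j hj => ?_
    have := (Finset.mem_filter.1 hj).2
    rw [bitEntropy_eq_stepEntropy] at this
    linarith
  have h2 : 0 ≤ (setH p β m).card * delta β m := by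
    unfold delta
    positivity
  have h3 := mul_le_mul_of_nonneg_left h1 (Real.log_pos one_lt_two).le
  have h4 := Real.log_two_lt_d9
  nlinarith

/-- Whatever the laws of the messages in `Ks`, the observations are nearly uniform. -/
theorem sum_abs_prob_eveObs_sub_le (hp0 : 0 ≤ p) (hp1 : p ≤ 1) (hμ : 0 < μ)
    {f : Fin ℓ → (Fin (2 ^ m) → ZMod 2) → ℝ} (hf0 : ∀ i v, 0 ≤ f i v)
    (hf1 : ∀ i, ∑ v, f i v = 1) (Ks : Finset (Fin ℓ)) (hf : ∀ i ∉ Ks, f i = srcProb p)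
    (φ : (Fin μ → ZMod 2) ≃ₗ[ZMod 2] GaloisField 2 μ)
    (G : Matrix (Fin ℓ) (Fin ℓ) (GaloisField 2 μ)) (W : Finset (Fin ℓ)) (hG : MixesOnto G W Ks) :
    ∑ z, |prob (lawOf β ℓ μ d p f) (fun ω => eveObs p β m ℓ μ d φ G W ω = z) -
      (Fintype.card (W → Fin (symCount (compLen p β m d) μ) → GaloisField 2 μ) : ℝ)⁻¹| ≤
      Real.sqrt (2 * ℓ * compLen p β m d * delta β m) := by
  -- Only the messages outside `Ks` are tilted; those in `Ks` cost no relative entropy.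
  set g : Fin ℓ → (Fin (2 ^ m) → ZMod 2) → ℝ :=
    fun i => if i ∈ Ks then f i else tiltedSrc p β m with hg
  have hg1 : ∀ i, ∑ v, g i v = 1 := fun i => by
    by_cases hi : i ∈ Ks
    · simp [hg, hi, hf1]
    · simp [hg, hi, sum_tiltedSrc]
  have hg0 : ∀ i v, 0 ≤ g i v := fun i v => by
    by_cases hi : i ∈ Ks
    · simp [hg, hi, hf0]
    · simp [hg, hi, tiltedSrc_nonneg hp0 hp1]
  have hfg : ∀ i v, g i v = 0 → f i v = 0 := fun i v => by
    by_cases hi : i ∈ Ks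
    · simp [hg, hi]
    · simp only [hg, hi, hf, if_false, not_false_eq_true]
      exact eq_zero_of_tilt_eq_zero (srcProb_nonneg hp0 hp1) _
  have hunif := prob_eveObs_tilted (d := d) hμ hg1 Ks (fun i hi => if_neg hi) φ G W hG
  have htv := sum_abs_prob_sub_le (lawOf β ℓ μ d p f) (lawOf β ℓ μ d p g)
    (eveObs p β m ℓ μ d φ G W)
  simp only [hunif] at htv
  refine htv.trans ?_
  rw [sum_abs_lawOf_sub]
  refine Real.le_sqrt_of_sq_le ((pinsker (fun v => Finset.prod_nonneg fun i _ => hf0 i (v i))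
    (fun v => Finset.prod_nonneg fun i _ => hg0 i (v i)) (fun v hv => ?_)
    (sum_prod_eq_one hf1) (sum_prod_eq_one hg1)).trans ?_)
  · obtain ⟨i, hi, h0⟩ := Finset.prod_eq_zero_iff.1 hv
    exact Finset.prod_eq_zero hi (hfg i _ h0)
  · rw [relEntropy_prod hfg hf1]
    have h1 : ∀ i ∈ Finset.univ, relEntropy (f i) (g i) ≤ compLen p β m d * delta β m := by
      intro i _
      have hδ : 0 < delta β m := by
        unfold delta
        positivity
      by_cases hi : i ∈ Ks
      · simp only [hg, hi, if_true, relEntropy_self]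
        positivity
      · simp only [hg, hi, if_false, hf i hi]
        refine (relEntropy_tiltedSrc_le hp0 hp1).trans (mul_le_mul_of_nonneg_right ?_ hδ.le)
        exact_mod_cast Nat.le_add_right _ _
    have h2 := Finset.sum_le_card_nsmul _ _ _ h1
    rw [Finset.card_univ, Fintype.card_fin, nsmul_eq_mul] at h2
    linarith

theorem leakage_le (hp0 : 0 ≤ p) (hp1 : p ≤ 1) (hμ : 0 < μ)
    (φ : (Fin μ → ZMod 2) ≃ₗ[ZMod 2] GaloisField 2 μ)
    (G : Matrix (Fin ℓ) (Fin ℓ) (GaloisField 2 μ)) (W Ks : Finset (Fin ℓ)) (hG : MixesOnto G W Ks)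
    (v : Ks → Fin (2 ^ m) → ZMod 2)
    (hv : prob (law p β m ℓ μ d) (fun ω => srcOn Ks ω = v) ≠ 0) :
    leakage p β m ℓ μ d φ G W Ks v ≤ leakBound p β m ℓ d := by
  -- Conditioning on `V_Ks = v` amounts to replacing the laws in `Ks` by point masses, by
  -- independence; `c` is the probability of the condition.
  set f : Fin ℓ → (Fin (2 ^ m) → ZMod 2) → ℝ := fun i =>
    if h : i ∈ Ks then fun b => if b = v ⟨i, h⟩ then 1 else 0 else srcProb p with hf
  set c : ℝ := ∏ i, if h : i ∈ Ks then srcProb p (v ⟨i, h⟩) else 1 with hc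
  have hf0 : ∀ i b, 0 ≤ f i b := fun i b => by
    by_cases hi : i ∈ Ks
    · simp only [hf, hi, dif_pos]
      split_ifs <;> norm_num
    · simp only [hf, hi, dif_neg, not_false_eq_true]
      exact srcProb_nonneg hp0 hp1 b
  have hf1 : ∀ i, ∑ b, f i b = 1 := fun i => by
    by_cases hi : i ∈ Ks
    · simp [hf, hi]
    · simp only [hf, hi, dif_neg, not_false_eq_true]
      exact sum_srcProb p _
  have hlaw : ∀ ω : Outcome p β m ℓ μ d,
      (if srcOn Ks ω = v then law p β m ℓ μ d ω else 0) = c * lawOf β ℓ μ d p f ω := by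
    intro ω
    rw [law_eq_lawOf, lawOf, lawOf, ← mul_assoc, ← mul_assoc, hc, ← Finset.prod_mul_distrib]
    split_ifs with h
    · congr 2
      refine Finset.prod_congr rfl fun i _ => ?_
      by_cases hi : i ∈ Ks
      · have : ω.1 i = v ⟨i, hi⟩ := congrFun h ⟨i, hi⟩
        simp [hf, hi, this]
      · simp [hf, hi]
    · obtain ⟨i, hi⟩ := Function.ne_iff.1 h
      have hi' : ω.1 i ≠ v i := hi
      rw [Finset.prod_eq_zero (Finset.mem_univ i.1)]
      · simp
      · simp [hf, hi']
  have hjoint : ∀ E : Outcome p β m ℓ μ d → Prop,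
      prob (law p β m ℓ μ d) (fun ω => E ω ∧ srcOn Ks ω = v) = c * prob (lawOf β ℓ μ d p f) E := by
    intro E
    rw [← prob_mul_const]
    unfold prob
    refine Finset.sum_congr rfl fun ω _ => ?_
    beta_reduce
    rw [← hlaw]
    by_cases hE : E ω <;> simp [hE]
  have hmarg : prob (law p β m ℓ μ d) (fun ω => srcOn Ks ω = v) = c := by
    have := hjoint fun _ => True
    rw [prob_of_forall _ fun _ => trivial, sum_lawOf hf1, mul_one] at this
    simpa using this
  rw [hmarg] at hv
  have h1 := sum_abs_prob_eveObs_sub_le (β := β) (d := d) hp0 hp1 hμ hf0 hf1 Ks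
    (fun i hi => by simp [hf, hi]) φ G W hG
  have h2 := sum_abs_prob_eveObs_sub_le (β := β) (m := m) (d := d) hp0 hp1 hμ
    (f := fun _ => srcProb p)
    (fun _ => srcProb_nonneg hp0 hp1) (fun _ => sum_srcProb p _) Ks (fun _ _ => rfl) φ G W hG
  unfold leakage leakBound
  rw [two_mul (Real.sqrt _)]
  refine le_trans ?_ (add_le_add h1 h2)
  rw [← Finset.sum_add_distrib]
  refine Finset.sum_le_sum fun z _ => ?_
  rw [hmarg, hjoint, mul_div_cancel_left₀ _ hv, law_eq_lawOf]
  rw [abs_sub_comm (prob (lawOf β ℓ μ d p fun _ => srcProb p) _)]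
  exact abs_sub_le _ _ _

end Secrecy

/-! ### Linear codes that mix -/

section Mixing

variable {ℓ μ : ℕ}

/-- The messages in `R` and the links in `W` form a square system, so injectivity gives
surjectivity. -/
theorem mixesOnto_of_injective {G : Matrix (Fin ℓ) (Fin ℓ) (GaloisField 2 μ)}
    {W Ks R : Finset (Fin ℓ)} (hR : ∀ k ∈ Ks, k ∉ R) (hcard : R.card = W.card)
    (hinj : ∀ a : Fin ℓ → GaloisField 2 μ, (∀ k ∉ R, a k = 0) →
      (∀ i ∈ W, ∑ k, G k i * a k = 0) → a = 0) : MixesOnto G W Ks := by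
  classical
  set T : Matrix W R (GaloisField 2 μ) := Matrix.of fun i k => G k i with hT
  set ext : (R → GaloisField 2 μ) → Fin ℓ → GaloisField 2 μ :=
    fun a k => if h : k ∈ R then a ⟨k, h⟩ else 0 with hext
  have hsum : ∀ (a : R → GaloisField 2 μ) (i : W), ∑ k, G k i * ext a k = T.mulVec a i := by
    intro a i
    rw [← Finset.sum_subset (Finset.subset_univ R) fun k _ hk => by simp [hext, hk],
      ← Finset.sum_coe_sort R]
    simp [hext, hT, Matrix.mulVec, dotProduct]
  have hTinj : Function.Injective T.mulVecLin := by
    rw [← LinearMap.ker_eq_bot, LinearMap.ker_eq_bot']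
    intro a ha
    have h0 := hinj (ext a) (fun k hk => dif_neg hk) fun i hi =>
      (hsum a ⟨i, hi⟩).trans (congrFun ha ⟨i, hi⟩)
    funext k
    have := congrFun h0 k
    simpa [hext] using this
  have hTsurj := (LinearMap.injective_iff_surjective_of_finrank_eq_finrank
    (by simp [hcard])).1 hTinj
  intro y
  obtain ⟨a, ha⟩ := hTsurj y
  refine ⟨ext a, fun k hk => dif_neg (hR k hk), fun i => ?_⟩
  rw [hsum, ← ha, Matrix.mulVecLin_apply]

theorem MixesOnto.mono {G : Matrix (Fin ℓ) (Fin ℓ) (GaloisField 2 μ)} {W W' Ks : Finset (Fin ℓ)}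
    (h : MixesOnto G W' Ks) (hW : W ⊆ W') : MixesOnto G W Ks := by
  classical
  intro y
  obtain ⟨c, hc0, hc⟩ := h fun i => if hi : i.1 ∈ W then y ⟨i, hi⟩ else 0
  exact ⟨c, hc0, fun i => by simpa using hc ⟨i, hW i.2⟩⟩

theorem rankWeight_le_of_eq_zero {c : Fin ℓ → GaloisField 2 μ} (W : Finset (Fin ℓ))
    (hc : ∀ i ∈ W, c i = 0) : rankWeight c ≤ ℓ - W.card := by
  classical
  have hle : Submodule.span (ZMod 2) (Set.range c) ≤
      Submodule.span (ZMod 2) ((Wᶜ.image c : Finset (GaloisField 2 μ)) : Set (GaloisField 2 μ)) := by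
    rw [Submodule.span_le]
    rintro _ ⟨i, rfl⟩
    by_cases hi : i ∈ W
    · rw [hc i hi]
      exact Submodule.zero_mem _
    · exact Submodule.subset_span (by simpa using ⟨i, hi, rfl⟩)
  refine (Submodule.finrank_mono hle).trans ((finrank_span_finset_le_card _).trans ?_)
  refine Finset.card_image_le.trans ?_
  rw [Finset.card_compl, Fintype.card_fin]

theorem rowCode_eq_span_range (G : Matrix (Fin ℓ) (Fin ℓ) (GaloisField 2 μ))
    (Ks : Finset (Fin ℓ)) : rowCode G Ks =
      Submodule.span (GaloisField 2 μ) (Set.range fun k : {k // k ∉ Ks} => G k) := by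
  unfold rowCode
  congr 1
  exact Set.image_eq_range (fun k => G k) _

theorem finrank_rowCode {G : Matrix (Fin ℓ) (Fin ℓ) (GaloisField 2 μ)} (hG : IsUnit G.det)
    (Ks : Finset (Fin ℓ)) : Module.finrank (GaloisField 2 μ) (rowCode G Ks) = ℓ - Ks.card := by
  classical
  have hli : LinearIndependent (GaloisField 2 μ) fun k : {k // k ∉ Ks} => G k :=
    (Matrix.linearIndependent_rows_iff_isUnit.2 ((Matrix.isUnit_iff_isUnit_det G).2 hG)).comp _
      Subtype.val_injective
  rw [rowCode_eq_span_range, finrank_span_eq_card hli, Fintype.card_subtype_compl]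
  simp

/-- A maximum rank distance code takes all values on any `w ≤ dim C` coordinates. -/
theorem mixesOnto_of_isMRD {G : Matrix (Fin ℓ) (Fin ℓ) (GaloisField 2 μ)} (hG : IsUnit G.det)
    {W Ks : Finset (Fin ℓ)} (hW : W.card ≤ ℓ - Ks.card) (hMRD : IsMRD (rowCode G Ks)) :
    MixesOnto G W Ks := by
  classical
  -- Enlarging `W` to exactly `dim C` coordinates makes the system square.
  obtain ⟨W', hWW', hW'⟩ := Finset.exists_superset_card_eq hW (by simp)
  have hKs := Finset.card_le_univ Ks
  rw [Fintype.card_fin] at hKs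
  refine MixesOnto.mono (W' := W') ?_ hWW'
  refine mixesOnto_of_injective (R := Ksᶜ) (by simp)
    (by rw [hW', Finset.card_compl, Fintype.card_fin]) fun a ha h0 => ?_
  have hmem : Matrix.vecMul a G ∈ rowCode G Ks := by
    have : Matrix.vecMul a G = ∑ k, a k • G k := by
      ext i
      simp [Matrix.vecMul, dotProduct]
    rw [this]
    refine Submodule.sum_mem _ fun k _ => ?_
    by_cases hk : k ∈ Ks
    · rw [ha k (by simpa using hk), zero_smul]
      exact Submodule.zero_mem _
    · exact Submodule.smul_mem _ _ (Submodule.subset_span ⟨k, hk, rfl⟩)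
  have hvan : ∀ i ∈ W', Matrix.vecMul a G i = 0 := fun i hi => by
    rw [← h0 i hi]
    simp only [Matrix.vecMul, dotProduct, mul_comm]
  by_contra hne
  have hGu := (Matrix.isUnit_iff_isUnit_det G).2 hG
  have h1 := hMRD _ hmem fun h => hne (Matrix.vecMul_injective_of_isUnit hGu (by simpa using h))
  have h2 := rankWeight_le_of_eq_zero W' hvan
  rw [finrank_rowCode hG] at h1
  omega

end Mixing

/-! ### Codes from Cauchy matrices -/

section Cauchy

variable {F ι : Type*} [Field F]

/-- Clearing denominators in the partial fractions gives a polynomial of degree less than `R.card`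
with zeros at the `y i`, `i ∈ W`. It is therefore zero, and its value at `x k` is `a k` times a
nonzero product. -/
theorem eq_zero_of_sum_cauchy_eq_zero {x y : ι → F} (hx : Function.Injective x)
    (hy : Function.Injective y) (hxy : ∀ i j, x i ≠ y j) {R W : Finset ι}
    (hcard : R.card ≤ W.card) {a : ι → F} (h : ∀ i ∈ W, ∑ k ∈ R, (x k - y i)⁻¹ * a k = 0) :
    ∀ k ∈ R, a k = 0 := by
  classical
  set q : Polynomial F := ∑ k ∈ R, Polynomial.C (a k) * Lagrange.nodal (R.erase k) x with hq
  have hdeg : q.degree < W.card := by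
    refine (Polynomial.degree_sum_le _ _).trans_lt ((Finset.sup_lt_iff (WithBot.bot_lt_coe _)).2
      fun k hk => ?_)
    refine (Polynomial.degree_mul_le _ _).trans_lt ?_
    refine (add_le_add_left Polynomial.degree_C_le _).trans_lt ?_
    rw [zero_add, Lagrange.degree_nodal]
    exact_mod_cast (Finset.card_erase_lt_of_mem hk).trans_le hcard
  have hq0 : q = 0 := by
    refine Polynomial.eq_zero_of_degree_lt_of_eval_index_eq_zero _ hy.injOn hdeg fun i hi => ?_
    have h1 : q.eval (y i) = -((∏ k' ∈ R, (y i - x k')) * ∑ k ∈ R, (x k - y i)⁻¹ * a k) := by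
      rw [hq, Polynomial.eval_finsetSum, Finset.mul_sum, ← Finset.sum_neg_distrib]
      refine Finset.sum_congr rfl fun k hk => ?_
      rw [← Finset.mul_prod_erase R _ hk, Polynomial.eval_mul, Polynomial.eval_C,
        Lagrange.eval_nodal]
      have := sub_ne_zero.2 (hxy k i)
      field_simp
      ring
    rw [h1, h i hi, mul_zero, neg_zero]
  intro k hk
  have h2 : q.eval (x k) = a k * ∏ k' ∈ R.erase k, (x k - x k') := by
    rw [hq, Polynomial.eval_finsetSum, Finset.sum_eq_single k]
    · simp [Lagrange.eval_nodal]
    · intro k' _ hne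
      rw [Polynomial.eval_mul, Lagrange.eval_nodal_at_node (Finset.mem_erase.2 ⟨hne.symm, hk⟩),
        mul_zero]
    · exact fun h => absurd hk h
  rw [hq0, Polynomial.eval_zero, eq_comm, mul_eq_zero] at h2
  refine h2.resolve_right (Finset.prod_ne_zero_iff.2 fun k' hk' => ?_)
  exact sub_ne_zero.2 fun h => (Finset.ne_of_mem_erase hk') (hx h).symm

variable {ℓ μ : ℕ}

/-- Over `𝔽_{2^μ}` with `μ ≥ ℓ` some invertible matrix mixes every set of at least
`W.card` messages onto the links in `W`. -/
theorem exists_mixesOnto (hℓ : 0 < ℓ) (hμ : ℓ ≤ μ) :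
    ∃ G : Matrix (Fin ℓ) (Fin ℓ) (GaloisField 2 μ), IsUnit G.det ∧
      ∀ W Ks : Finset (Fin ℓ), W.card ≤ ℓ - Ks.card → MixesOnto G W Ks := by
  classical
  have hcardF : Fintype.card (GaloisField 2 μ) = 2 ^ μ := by
    rw [← Nat.card_eq_fintype_card, GaloisField.card 2 μ (by omega)]
  -- The Cauchy matrix needs `2 * ℓ ≤ 2 * μ ≤ 2 ^ μ` distinct field elements.
  have h2 : 2 * μ ≤ 2 ^ μ := by
    obtain ⟨k, rfl⟩ : ∃ k, μ = k + 1 := ⟨μ - 1, by omega⟩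
    have := Nat.lt_two_pow_self (n := k)
    rw [pow_succ]
    omega
  obtain ⟨e⟩ : Nonempty (Fin ℓ ⊕ Fin ℓ ↪ GaloisField 2 μ) :=
    Function.Embedding.nonempty_of_card_le (by simp [hcardF]; omega)
  set x : Fin ℓ → GaloisField 2 μ := fun i => e (Sum.inl i) with hx
  set y : Fin ℓ → GaloisField 2 μ := fun i => e (Sum.inr i) with hy
  have hxi : Function.Injective x := e.injective.comp Sum.inl_injective
  have hyi : Function.Injective y := e.injective.comp Sum.inr_injective
  have hxy : ∀ i j, x i ≠ y j := fun i j h => by simpa using e.injective h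
  refine ⟨Matrix.of fun k i => (x k - y i)⁻¹, ?_, fun W Ks hW => ?_⟩
  · rw [← Matrix.isUnit_iff_isUnit_det, ← Matrix.linearIndependent_rows_iff_isUnit,
      Fintype.linearIndependent_iff]
    intro a ha k
    refine eq_zero_of_sum_cauchy_eq_zero hxi hyi hxy (R := Finset.univ) (W := Finset.univ) le_rfl
      (fun i _ => ?_) k (Finset.mem_univ k)
    have := congrFun ha i
    simpa [mul_comm] using this
  · obtain ⟨R, hR, hRc⟩ := Finset.exists_subset_card_eq (s := Ksᶜ) (n := W.card)
      (by rwa [Finset.card_compl, Fintype.card_fin])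
    refine mixesOnto_of_injective (R := R) (fun k hk hkR => by simpa [hk] using hR hkR) hRc
      fun a ha h0 => ?_
    have h1 := eq_zero_of_sum_cauchy_eq_zero hxi hyi hxy (R := R) (W := W) hRc.le (a := a)
      fun i hi => by
        rw [← h0 i hi]
        refine Finset.sum_subset (Finset.subset_univ R) fun k _ hk => ?_
        rw [ha k hk, mul_zero]
    funext k
    by_cases hk : k ∈ R
    · exact h1 k hk
    · exact ha k hk

end Cauchy

/-! ### Gabidulin codes -/

section Gabidulin

variable {ℓ μ : ℕ}

/-- The linearized polynomial `∑ a_i x ^ (2 ^ i)` as a linear map over `𝔽_2`. -/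
def linearized (a : Fin ℓ → GaloisField 2 μ) : GaloisField 2 μ →ₗ[ZMod 2] GaloisField 2 μ :=
  AddMonoidHom.toZModLinearMap 2
    { toFun := fun x => ∑ i, a i * x ^ 2 ^ i.val
      map_zero' := by simp
      map_add' := fun x y => by
        simp [add_pow_char_pow, mul_add, Finset.sum_add_distrib] }

theorem linearized_apply (a : Fin ℓ → GaloisField 2 μ) (x : GaloisField 2 μ) :
    linearized a x = ∑ i, a i * x ^ 2 ^ i.val := rfl

/-- A nonzero linearized polynomial of `2`-degree less than `r` has a kernel of dimension less
than `r`. -/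
theorem finrank_ker_linearized_lt {a : Fin ℓ → GaloisField 2 μ} (ha : a ≠ 0) {r : ℕ}
    (hr : ∀ i : Fin ℓ, r ≤ i.val → a i = 0) :
    Module.finrank (ZMod 2) (LinearMap.ker (linearized a)) < r := by
  classical
  obtain ⟨i₀, hi₀⟩ := Function.ne_iff.1 ha
  have hi₀r : i₀.val < r := by
    by_contra h
    exact hi₀ (hr i₀ (by omega))
  set q : Polynomial (GaloisField 2 μ) :=
    ∑ i, Polynomial.C (a i) * Polynomial.X ^ 2 ^ i.val with hq
  have hq0 : q ≠ 0 := by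
    intro h
    have h1 : q.coeff (2 ^ i₀.val) = a i₀ := by
      rw [hq, Polynomial.finsetSum_coeff, Finset.sum_eq_single i₀]
      · simp
      · intro i _ hi
        rw [Polynomial.coeff_C_mul_X_pow, if_neg]
        exact fun h => hi (Fin.ext (Nat.pow_right_injective le_rfl h)).symm
      · simp
    rw [h, Polynomial.coeff_zero] at h1
    exact hi₀ h1.symm
  have hdeg : q.natDegree ≤ 2 ^ (r - 1) := by
    refine Polynomial.natDegree_sum_le_of_forall_le _ _ fun i _ => ?_
    by_cases hi : r ≤ i.val
    · simp [hr i hi]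
    · exact (Polynomial.natDegree_C_mul_X_pow_le _ _).trans
        (Nat.pow_le_pow_right two_pos (by omega))
  have hsub : ∀ x ∈ LinearMap.ker (linearized a), x ∈ q.roots.toFinset := by
    intro x hx
    rw [Multiset.mem_toFinset, Polynomial.mem_roots hq0, Polynomial.IsRoot.def, hq,
      Polynomial.eval_finsetSum]
    simpa [linearized_apply] using hx
  have hcard : Fintype.card (LinearMap.ker (linearized a)) ≤ 2 ^ (r - 1) := by
    calc Fintype.card (LinearMap.ker (linearized a))
        ≤ Fintype.card q.roots.toFinset :=
          Fintype.card_le_of_injective (fun x => ⟨x.1, hsub x.1 x.2⟩)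
            fun x y h => Subtype.ext (Subtype.mk.inj h)
      _ ≤ Multiset.card q.roots := by
          rw [Fintype.card_coe]
          exact Multiset.toFinset_card_le _
      _ ≤ 2 ^ (r - 1) := (Polynomial.card_roots' q).trans hdeg
  -- The kernel consists of roots of `q`, and its size is the power of 2 given by its dimension,
  -- which is thus at most `r - 1`.
  rw [Module.card_eq_pow_finrank (K := ZMod 2), ZMod.card] at hcard
  have := (Nat.pow_le_pow_iff_right one_lt_two).1 hcard
  omega

/-- The rank weight of an evaluation codeword at independent points. -/
theorem lt_rankWeight_linearized_add {g : Fin ℓ → GaloisField 2 μ}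
    (hg : LinearIndependent (ZMod 2) g) {a : Fin ℓ → GaloisField 2 μ} (ha : a ≠ 0) {r : ℕ}
    (hr : ∀ i : Fin ℓ, r ≤ i.val → a i = 0) :
    ℓ < rankWeight (fun j => linearized a (g j)) + r := by
  -- The entries span the image of `V`, of dimension `ℓ` by independence, so rank–nullity applies.
  set V := Submodule.span (ZMod 2) (Set.range g) with hV
  have h1 : rankWeight (fun j => linearized a (g j)) =
      Module.finrank (ZMod 2) (LinearMap.range ((linearized a).domRestrict V)) := by
    rw [LinearMap.range_domRestrict, hV, Submodule.map_span, ← Set.range_comp]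
    rfl
  have h2 := LinearMap.finrank_range_add_finrank_ker ((linearized a).domRestrict V)
  rw [finrank_span_eq_card hg, Fintype.card_fin] at h2
  have h3 : Module.finrank (ZMod 2) (LinearMap.ker ((linearized a).domRestrict V)) ≤
      Module.finrank (ZMod 2) (LinearMap.ker (linearized a)) := by
    rw [← Submodule.finrank_map_subtype_eq]
    refine Submodule.finrank_mono ?_
    rintro _ ⟨x, hx, rfl⟩
    exact hx
  have h4 := finrank_ker_linearized_lt ha hr
  omega

/-- Every set of rows has an invertible matrix whose other rows generate a Gabidulin code. -/
theorem exists_isMRD_rowCode (hμ : ℓ ≤ μ) (Ks : Finset (Fin ℓ)) :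
    ∃ G : Matrix (Fin ℓ) (Fin ℓ) (GaloisField 2 μ), IsUnit G.det ∧ IsMRD (rowCode G Ks) := by
  classical
  obtain ⟨g, hg⟩ : ∃ g : Fin ℓ → GaloisField 2 μ, LinearIndependent (ZMod 2) g := by
    refine exists_linearIndependent_of_le_finrank ?_
    rcases Nat.eq_zero_or_pos μ with h0 | h0
    · omega
    · rwa [GaloisField.finrank 2 h0.ne']
  have hKs := Finset.card_le_univ Ks
  rw [Fintype.card_fin] at hKs
  have hcard : Fintype.card {k // k ∉ Ks} = Fintype.card {i : Fin ℓ // i.val < ℓ - Ks.card} := by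
    rw [Fintype.card_subtype_compl, Fintype.card_fin, Fintype.card_coe,
      Fintype.card_subtype, Fin.card_filter_val_lt]
    omega
  -- The rows outside `Ks` receive the lowest Frobenius exponents, so they generate a Gabidulin
  -- code.
  set e : Equiv.Perm (Fin ℓ) := (Fintype.equivOfCardEq hcard).extendSubtype with he
  have he1 : ∀ k ∉ Ks, (e k).val < ℓ - Ks.card := fun k hk =>
    Equiv.extendSubtype_mem (q := fun i : Fin ℓ => i.val < ℓ - Ks.card) _ k hk
  set G : Matrix (Fin ℓ) (Fin ℓ) (GaloisField 2 μ) :=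
    Matrix.of fun k j => g j ^ 2 ^ (e k).val with hG
  have hcomb : ∀ b : Fin ℓ → GaloisField 2 μ,
      ∑ k, b k • G k = fun j => linearized (b ∘ e.symm) (g j) := by
    intro b
    funext j
    rw [Finset.sum_apply, linearized_apply,
      ← Equiv.sum_comp e fun i => (b ∘ e.symm) i * g j ^ 2 ^ i.val]
    simp [hG]
  have hcomp : ∀ b : Fin ℓ → GaloisField 2 μ, b ∘ e.symm = 0 → b = 0 := fun b h => by
    funext k
    simpa using congrFun h (e k)
  -- The case `r = ℓ`: a nontrivial combination of rows has positive rank weight, hence is nonzero.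
  have hdet : IsUnit G.det := by
    rw [← Matrix.isUnit_iff_isUnit_det, ← Matrix.linearIndependent_rows_iff_isUnit,
      Fintype.linearIndependent_iff]
    intro b hb
    by_contra! hne
    obtain ⟨k, hk⟩ := hne
    have h1 := lt_rankWeight_linearized_add hg (a := b ∘ e.symm) (r := ℓ)
      (fun h => hk (congrFun (hcomp b h) k)) fun i hi => absurd i.isLt (by omega)
    have h2 : rankWeight (fun j => linearized (b ∘ e.symm) (g j)) ≤ ℓ - Finset.univ.card :=
      rankWeight_le_of_eq_zero Finset.univ fun j _ => by
        rw [← congrFun (hcomb b) j]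
        exact congrFun hb j
    rw [Finset.card_univ, Fintype.card_fin] at h2
    omega
  refine ⟨G, hdet, fun c hc hc0 => ?_⟩
  rw [finrank_rowCode hdet]
  rw [rowCode_eq_span_range, Submodule.mem_span_range_iff_exists_fun] at hc
  obtain ⟨b', hb'⟩ := hc
  set b : Fin ℓ → GaloisField 2 μ := fun k => if h : k ∉ Ks then b' ⟨k, h⟩ else 0 with hb
  have hbc : ∑ k, b k • G k = c := by
    rw [← hb', ← Finset.sum_subset (Finset.subset_univ Ksᶜ) fun k _ hk => by
      rw [show b k = 0 from dif_neg (by simpa using hk), zero_smul]]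
    rw [Finset.sum_subtype (p := fun k => k ∉ Ks) Ksᶜ (by simp)]
    exact Finset.sum_congr rfl fun k _ => by rw [show b k = b' k from dif_pos k.2]
  have hb0 : b ∘ e.symm ≠ 0 := fun h => hc0 (by rw [← hbc, hcomp b h]; simp)
  rw [← hbc, hcomb]
  refine lt_rankWeight_linearized_add hg hb0 fun i hi => ?_
  refine dif_neg fun h => ?_
  have := he1 _ h
  rw [Equiv.apply_symm_apply] at this
  omega

end Gabidulin

/-! ### Bounds and asymptotics -/

section Asymptotic

variable {p β : ℝ} {m ℓ μ d : ℕ}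

theorem delta_pos (β : ℝ) (m : ℕ) : 0 < delta β m := by
  unfold delta
  positivity

theorem errorProb_nonneg (hp0 : 0 ≤ p) (hp1 : p ≤ 1)
    (φ : (Fin μ → ZMod 2) ≃ₗ[ZMod 2] GaloisField 2 μ)
    (G : Matrix (Fin ℓ) (Fin ℓ) (GaloisField 2 μ)) : 0 ≤ errorProb p β m ℓ μ d φ G :=
  prob_nonneg (fun ω => by
    rw [law_eq_lawOf]
    exact lawOf_nonneg (fun _ => srcProb_nonneg hp0 hp1) ω) _

theorem sum_setU_bitEntropy_le (p β : ℝ) (m : ℕ) :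
    ∑ j ∈ setU p β m, bitEntropy p m j ≤ (setU p β m).card * delta β m := by
  rw [← nsmul_eq_mul]
  exact Finset.sum_le_card_nsmul _ _ _ fun j hj => (Finset.mem_filter.1 hj).2.le

theorem card_setU_le (p β : ℝ) (m : ℕ) : (setU p β m).card ≤ 2 ^ m :=
  (Finset.card_le_univ _).trans_eq (Fintype.card_fin _)

theorem errorProb_le (hp0 : 0 ≤ p) (hp1 : p ≤ 1) (hμ : 0 < μ)
    (φ : (Fin μ → ZMod 2) ≃ₗ[ZMod 2] GaloisField 2 μ)
    (G : Matrix (Fin ℓ) (Fin ℓ) (GaloisField 2 μ)) (hd : (setJ p β m).card ≤ d)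
    (hG : IsUnit G.det) :
    errorProb p β m ℓ μ d φ G ≤ ℓ * (setU p β m).card * delta β m := by
  refine (errorProb_le_sum_bitEntropy hp0 hp1 hμ φ G hd hG).trans ?_
  rw [mul_assoc]
  exact mul_le_mul_of_nonneg_left (sum_setU_bitEntropy_le p β m) (Nat.cast_nonneg ℓ)

theorem errorProb_le_blocklength (hp0 : 0 ≤ p) (hp1 : p ≤ 1) (hμ : 0 < μ)
    (φ : (Fin μ → ZMod 2) ≃ₗ[ZMod 2] GaloisField 2 μ)
    (G : Matrix (Fin ℓ) (Fin ℓ) (GaloisField 2 μ)) (hd : (setJ p β m).card ≤ d)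
    (hG : IsUnit G.det) :
    errorProb p β m ℓ μ d φ G ≤ ℓ * ((2 : ℝ) ^ m * delta β m) := by
  refine (errorProb_le hp0 hp1 hμ φ G hd hG).trans ?_
  rw [mul_assoc]
  have h1 : ((setU p β m).card : ℝ) ≤ (2 : ℝ) ^ m := by exact_mod_cast card_setU_le p β m
  have := delta_pos β m
  gcongr

theorem tendsto_two_pow_atTop : Tendsto (fun m : ℕ => (2 : ℝ) ^ m) atTop atTop :=
  tendsto_pow_atTop_atTop_of_one_lt one_lt_two

theorem tendsto_delta (hβ : 0 < β) : Tendsto (delta β) atTop (nhds 0) := by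
  have h1 : Tendsto (fun m : ℕ => ((2 : ℝ) ^ m) ^ β) atTop atTop :=
    (tendsto_rpow_atTop hβ).comp tendsto_two_pow_atTop
  have h2 := (tendsto_rpow_atBot_of_base_gt_one 2 one_lt_two).comp (tendsto_neg_atTop_atBot.comp h1)
  exact h2

/-- The factor `n` is absorbed by a smaller exponent. -/
theorem eventually_mul_delta_le {β' : ℝ} (hβ' : 0 ≤ β') (h : β' < β) :
    ∀ᶠ m : ℕ in atTop, (2 : ℝ) ^ m * delta β m ≤ delta β' m := by
  have hlog2 := Real.log_pos one_lt_two
  -- Half of `n ^ β` pays for the factor `n = 2 ^ m` (`m ≤ n ^ β / 2`), the other half for `n ^ β'`.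
  have h1 := (isLittleO_log_rpow_atTop (hβ'.trans_lt h)).def (half_pos hlog2)
  have h2 := (tendsto_rpow_atTop (sub_pos.2 h)).eventually_ge_atTop 2
  filter_upwards [tendsto_two_pow_atTop.eventually h1, tendsto_two_pow_atTop.eventually h2]
    with m hm1 hm2
  have hx : (0 : ℝ) < 2 ^ m := by positivity
  have hxβ := Real.rpow_pos_of_pos hx β
  have hxβ' := Real.rpow_pos_of_pos hx β'
  rw [Real.norm_of_nonneg hxβ.le] at hm1
  rw [Real.rpow_sub hx, le_div_iff₀ hxβ'] at hm2
  have hm3 := (Real.le_norm_self _).trans hm1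
  rw [Real.log_pow] at hm3
  have hm4 : (m : ℝ) ≤ ((2 : ℝ) ^ m) ^ β / 2 := by
    refine le_of_mul_le_mul_right ?_ hlog2
    linarith
  unfold delta
  rw [← Real.rpow_natCast, ← Real.rpow_add two_pos, Real.rpow_natCast]
  refine Real.rpow_le_rpow_of_exponent_le one_le_two ?_
  linarith

theorem sum_bitEntropy_eq_zero (hp : p = 0 ∨ p = 1) (m : ℕ) : ∑ j, bitEntropy p m j = 0 := by
  rw [sum_bitEntropy (by rcases hp with rfl | rfl <;> norm_num)
    (by rcases hp with rfl | rfl <;> norm_num), neg_eq_zero]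
  refine Finset.sum_eq_zero fun v _ => ?_
  by_cases hv : srcProb p v = 0
  · simp [hv]
  · have : srcProb p v = 1 := by
      refine Finset.prod_eq_one fun t ht => ?_
      have h1 := Finset.prod_ne_zero_iff.1 hv t ht
      rcases hp with rfl | rfl <;> split_ifs at h1 ⊢ <;> simp_all
    simp [this]

/-- The entropy of the block grows linearly unless the source is deterministic. -/
theorem exists_mul_le_sum_bitEntropy (hp0 : 0 < p) (hp1 : p < 1) :
    ∃ c : ℝ, 0 < c ∧ ∀ m : ℕ, (2 : ℝ) ^ m * c ≤ ∑ j, bitEntropy p m j := by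
  -- Every word has probability at most `M ^ n`, so it carries at least `n * (-logb 2 M)` bits.
  set M := max p (1 - p) with hM
  have hM0 : 0 < M := lt_max_of_lt_left hp0
  have hM1 : M < 1 := max_lt hp1 (by linarith)
  refine ⟨-Real.logb 2 M, neg_pos.2 (Real.logb_neg one_lt_two hM0 hM1), fun m => ?_⟩
  rw [sum_bitEntropy hp0.le hp1.le, ← Finset.sum_neg_distrib]
  calc (2 : ℝ) ^ m * -Real.logb 2 M
      = ∑ v : Fin (2 ^ m) → ZMod 2, srcProb p v * ((2 : ℝ) ^ m * -Real.logb 2 M) := by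
        rw [← Finset.sum_mul, sum_srcProb, one_mul]
    _ ≤ _ := by
        refine Finset.sum_le_sum fun v _ => ?_
        rw [← mul_neg]
        refine mul_le_mul_of_nonneg_left ?_ (srcProb_nonneg hp0.le hp1.le v)
        have hpos : 0 < srcProb p v := Finset.prod_pos fun t _ => by split_ifs <;> linarith
        have hle : srcProb p v ≤ M ^ (2 ^ m) := by
          refine (Finset.prod_le_prod (g := fun _ => M) (fun t _ => by split_ifs <;> linarith)
            fun t _ => ?_).trans_eq (by simp)
          split_ifs
          exacts [le_max_left _ _, le_max_right _ _]
        have h1 := Real.logb_le_logb_of_le one_lt_two hpos hle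
        rw [Real.logb_pow] at h1
        push_cast at h1
        linarith

/-- At most `ñ` indices lie outside `U_V`, each with at most one bit; those in `U_V` carry at most
`δ_n` each. -/
theorem sum_bitEntropy_le (hp0 : 0 ≤ p) (hp1 : p ≤ 1) (hd : (setJ p β m).card ≤ d) :
    ∑ j, bitEntropy p m j ≤ compLen p β m d + (2 : ℝ) ^ m * delta β m := by
  rw [← Finset.sum_compl_add_sum (setU p β m)]
  refine add_le_add ?_ ((sum_setU_bitEntropy_le p β m).trans ?_)
  · have h1 : ((setU p β m)ᶜ).card ≤ compLen p β m d := by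
      refine (Finset.card_le_card (t := setH p β m ∪ setJ p β m) fun j hj => ?_).trans
        ((Finset.card_union_le _ _).trans (Nat.add_le_add_left hd _))
      simp only [setJ, Finset.mem_union, Finset.mem_compl] at hj ⊢
      tauto
    have h2 := Finset.sum_le_card_nsmul (setU p β m)ᶜ (bitEntropy p m) 1
      fun j _ => bitEntropy_le_one hp0 hp1 j
    rw [nsmul_eq_mul, mul_one] at h2
    exact h2.trans (by exact_mod_cast h1)
  · have h1 : ((setU p β m).card : ℝ) ≤ (2 : ℝ) ^ m := by exact_mod_cast card_setU_le p β m
    exact mul_le_mul_of_nonneg_right h1 (delta_pos β m).le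

variable {ℓ μ d : ℕ → ℕ}

theorem tendsto_mul_compLen_mul_delta
    (h : (fun m => (ℓ m : ℝ)) =o[atTop]
      fun m => (2 : ℝ) ^ (((2 : ℝ) ^ m) ^ β) / (compLen p β m (d m) : ℝ)) :
    Tendsto (fun m => (ℓ m : ℝ) * compLen p β m (d m) * delta β m) atTop (nhds 0) := by
  refine h.tendsto_div_nhds_zero.congr fun m => ?_
  rw [div_div_eq_mul_div, delta, Real.rpow_neg two_pos.le, div_eq_mul_inv]

theorem tendsto_leakBound
    (h : (fun m => (ℓ m : ℝ)) =o[atTop]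
      fun m => (2 : ℝ) ^ (((2 : ℝ) ^ m) ^ β) / (compLen p β m (d m) : ℝ)) :
    Tendsto (fun m => leakBound p β m (ℓ m) (d m)) atTop (nhds 0) := by
  have h1 := (((tendsto_mul_compLen_mul_delta h).const_mul 2).sqrt).const_mul 2
  rw [mul_zero, Real.sqrt_zero, mul_zero] at h1
  refine h1.congr fun m => ?_
  rw [leakBound, ← mul_assoc, ← mul_assoc]

theorem tendsto_errorProb (hp0 : 0 ≤ p) (hp1 : p ≤ 1) (hβ : 0 ≤ β)
    (φ : ∀ m, (Fin (μ m) → ZMod 2) ≃ₗ[ZMod 2] GaloisField 2 (μ m))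
    (G : ∀ m, Matrix (Fin (ℓ m)) (Fin (ℓ m)) (GaloisField 2 (μ m)))
    (hℓ : ∀ m, 0 < ℓ m) (hμ : ∀ m, 0 < μ m) (hd : ∀ m, (setJ p β m).card ≤ d m)
    (hG : ∀ m, IsUnit (G m).det)
    (h : (fun m => (ℓ m : ℝ)) =o[atTop]
      fun m => (2 : ℝ) ^ (((2 : ℝ) ^ m) ^ β) / (compLen p β m (d m) : ℝ)) :
    Tendsto (fun m => errorProb p β m (ℓ m) (μ m) (d m) (φ m) (G m)) atTop (nhds 0) := by
  rcases hβ.eq_or_lt with rfl | hβ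
  -- For `β = 0` the hypothesis fails: it would give `ℓ ≤ (1/4) * (2/ñ) ≤ 1/2` for some `m`, against
  -- `ℓ ≥ 1`.
  · exfalso
    obtain ⟨m, hm⟩ := (h.def (show (0 : ℝ) < 1 / 4 by norm_num)).exists
    rw [Real.rpow_zero, Real.rpow_one, Real.norm_natCast, norm_div, Real.norm_natCast,
      Real.norm_two] at hm
    have h1 : (1 : ℝ) ≤ ℓ m := by exact_mod_cast hℓ m
    have h2 : (2 : ℝ) / compLen p 0 m (d m) ≤ 2 := by
      rcases Nat.eq_zero_or_pos (compLen p 0 m (d m)) with h0 | h0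
      · simp [h0]
      · exact div_le_self two_pos.le (by exact_mod_cast h0)
    linarith
  -- A deterministic source gives no linear lower bound on `ñ`, but all its entropies vanish and
  -- decoding is error-free.
  by_cases hp : p = 0 ∨ p = 1
  · have h0 : ∀ m, errorProb p β m (ℓ m) (μ m) (d m) (φ m) (G m) = 0 := by
      intro m
      refine le_antisymm ?_ (errorProb_nonneg hp0 hp1 _ _)
      refine (errorProb_le_sum_bitEntropy hp0 hp1 (hμ m) _ _ (hd m) (hG m)).trans ?_
      have h1 : ∑ j ∈ setU p β m, bitEntropy p m j ≤ 0 := by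
        rw [← sum_bitEntropy_eq_zero hp m]
        exact Finset.sum_le_sum_of_subset_of_nonneg (Finset.subset_univ _)
          fun j _ _ => bitEntropy_nonneg hp0 hp1 j
      exact mul_nonpos_of_nonneg_of_nonpos (Nat.cast_nonneg _) h1
    simp [h0]
  push Not at hp
  obtain ⟨c, hc, hent⟩ := exists_mul_le_sum_bitEntropy (lt_of_le_of_ne hp0 hp.1.symm)
    (lt_of_le_of_ne hp1 hp.2)
  have hlim := (tendsto_mul_compLen_mul_delta h).const_mul (2 / c)
  rw [mul_zero] at hlim
  refine squeeze_zero' (Eventually.of_forall fun m => errorProb_nonneg hp0 hp1 _ _) ?_ hlim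
  -- Once `δ_n < c/2`, the inequality `n c ≤ ñ + n δ_n` yields `n ≤ (2/c) ñ`.
  filter_upwards [(tendsto_delta hβ).eventually (gt_mem_nhds (half_pos hc))] with m hm
  have h1 := (hent m).trans (sum_bitEntropy_le hp0 hp1 (hd m))
  have hn : (0 : ℝ) < 2 ^ m := by positivity
  have h2 : (2 : ℝ) ^ m ≤ 2 / c * compLen p β m (d m) := by
    rw [div_mul_eq_mul_div, le_div_iff₀ hc]
    nlinarith
  refine (errorProb_le_blocklength hp0 hp1 (hμ m) _ _ (hd m) (hG m)).trans ?_
  have h3 := mul_le_mul_of_nonneg_left (mul_le_mul_of_nonneg_right h2 (delta_pos β m).le)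
    (Nat.cast_nonneg (α := ℝ) (ℓ m))
  refine h3.trans_eq (by ring)

end Asymptotic

end NUHUNCC

end

theorem theorem1 (p β : ℝ) (hp0 : 0 ≤ p) (hp1 : p ≤ 1) (hβ0 : 0 ≤ β) (hβ1 : β < 1 / 2) :
    -- every blocklength: reliability, and secrecy of the messages that select the coset
    (∀ (m ℓ w μ d : ℕ) (φ : (Fin μ → ZMod 2) ≃ₗ[ZMod 2] GaloisField 2 μ)
        (G : Matrix (Fin ℓ) (Fin ℓ) (GaloisField 2 μ)),
      w < ℓ → ℓ ≤ μ → (NUHUNCC.setJ p β m).card ≤ d → IsUnit G.det →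
        NUHUNCC.errorProb p β m ℓ μ d φ G ≤
            ℓ * (NUHUNCC.setU p β m).card * NUHUNCC.delta β m ∧
          ∀ Ks : Finset (Fin ℓ), Ks.card ≤ ℓ - w → NUHUNCC.IsMRD (NUHUNCC.rowCode G Ks) →
            NUHUNCC.SecuresUpTo (NUHUNCC.leakBound p β m ℓ d) p β m ℓ w μ d φ G Ks) ∧
    -- existence of the codes over every field with `μ ≥ ℓ`: one that is MRD-based for a given set
    -- of messages, and one linear code that secures all sets of messages simultaneously
    (∀ ℓ w μ : ℕ, w < ℓ → ℓ ≤ μ →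
      (∀ Ks : Finset (Fin ℓ), Ks.card ≤ ℓ - w →
        ∃ G : Matrix (Fin ℓ) (Fin ℓ) (GaloisField 2 μ),
          IsUnit G.det ∧ NUHUNCC.IsMRD (NUHUNCC.rowCode G Ks)) ∧
      ∃ G : Matrix (Fin ℓ) (Fin ℓ) (GaloisField 2 μ), IsUnit G.det ∧
        ∀ (m d : ℕ) (φ : (Fin μ → ZMod 2) ≃ₗ[ZMod 2] GaloisField 2 μ),
          (NUHUNCC.setJ p β m).card ≤ d → ∀ Ks : Finset (Fin ℓ), Ks.card ≤ ℓ - w →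
            NUHUNCC.SecuresUpTo (NUHUNCC.leakBound p β m ℓ d) p β m ℓ w μ d φ G Ks) ∧
    -- error at most `ℓ 2 ^ (-n ^ β')` for large `n`, for every exponent `β' < β`
    (∀ β' : ℝ, 0 ≤ β' → β' < β → ∀ᶠ m : ℕ in atTop, ∀ (ℓ w μ d : ℕ)
        (φ : (Fin μ → ZMod 2) ≃ₗ[ZMod 2] GaloisField 2 μ)
        (G : Matrix (Fin ℓ) (Fin ℓ) (GaloisField 2 μ)),
      w < ℓ → ℓ ≤ μ → (NUHUNCC.setJ p β m).card ≤ d → IsUnit G.det →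
        NUHUNCC.errorProb p β m ℓ μ d φ G ≤ ℓ * NUHUNCC.delta β' m) ∧
    -- both are negligible when `ℓ = o(2 ^ (n ^ β) / ñ)`
    (∀ (ℓ w μ d : ℕ → ℕ)
        (φ : ∀ m, (Fin (μ m) → ZMod 2) ≃ₗ[ZMod 2] GaloisField 2 (μ m))
        (G : ∀ m, Matrix (Fin (ℓ m)) (Fin (ℓ m)) (GaloisField 2 (μ m))),
      (∀ m, w m < ℓ m) → (∀ m, ℓ m ≤ μ m) → (∀ m, (NUHUNCC.setJ p β m).card ≤ d m) →
      (∀ m, IsUnit (G m).det) →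
      (fun m => (ℓ m : ℝ)) =o[atTop]
        (fun m => (2 : ℝ) ^ (((2 : ℝ) ^ m) ^ β) / (NUHUNCC.compLen p β m (d m) : ℝ)) →
        Tendsto (fun m => NUHUNCC.errorProb p β m (ℓ m) (μ m) (d m) (φ m) (G m)) atTop (nhds 0) ∧
          Tendsto (fun m => NUHUNCC.leakBound p β m (ℓ m) (d m)) atTop (nhds 0)) := by
  refine ⟨?_, ?_, ?_, ?_⟩
  · intro m ℓ w μ d φ G hw hμ hd hG
    refine ⟨NUHUNCC.errorProb_le hp0 hp1 (by omega) φ G hd hG, ?_⟩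
    intro Ks hKs hMRD W hW v hv
    exact NUHUNCC.leakage_le hp0 hp1 (by omega) φ G W Ks
      (NUHUNCC.mixesOnto_of_isMRD hG (by omega) hMRD) v hv
  · intro ℓ w μ hw hμ
    refine ⟨fun Ks _ => NUHUNCC.exists_isMRD_rowCode hμ Ks, ?_⟩
    obtain ⟨G, hG, hmix⟩ := NUHUNCC.exists_mixesOnto (ℓ := ℓ) (by omega) hμ
    refine ⟨G, hG, fun m d φ _ Ks hKs W hW v hv => ?_⟩
    exact NUHUNCC.leakage_le hp0 hp1 (by omega) φ G W Ks (hmix W Ks (by omega)) v hv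
  · intro β' hβ' hlt
    filter_upwards [NUHUNCC.eventually_mul_delta_le hβ' hlt] with m hm ℓ w μ d φ G hw hμ hd hG
    exact (NUHUNCC.errorProb_le_blocklength hp0 hp1 (by omega) φ G hd hG).trans
      (mul_le_mul_of_nonneg_left hm (Nat.cast_nonneg ℓ))
  · intro ℓ w μ d φ G hw hμ hd hG h
    exact ⟨NUHUNCC.tendsto_errorProb hp0 hp1 hβ0 φ G (fun m => (Nat.zero_le _).trans_lt (hw m))
      (fun m => ((Nat.zero_le _).trans_lt (hw m)).trans_le (hμ m)) hd hG h,
      NUHUNCC.tendsto_leakBound h⟩
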